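/- **Theorem.** Let $\alpha\in(0,1)$, $\lambda>0$, $\gamma_1,\gamma_2>0$. Let $F_1$ be a distribution function of a probability law on $[0,\infty)$ with $1-F_1(x)=e^{-\lambda x}(1+o(1))$, and $F_2$ that of a probability law on $[1,\infty)$ with $1-F_2(x)=x^{-\alpha}(1+o(1))$, as $x\to+\infty$. For $M$ with $F_2(M)>0$ let $F_2^M$ be the law $F_2$ conditioned on $(-\infty,M]$, i.e. $F_2^M(x)=F_2(x)/F_2(M)$ for $x\le M$ and $F_2^M(x)=1$ for $x>M$. Put $M_n=n^{\gamma_1}$, $\varepsilon_n=n^{-\gamma_2}$. For every $n$ let $X_{n1},\dots,X_{nn}\sim F_1$, $Y_{n1},\dots,Y_{nn}\sim F_2^{M_n}$ (this is required only for those $n$ with $F_2(M_n)>0$, thus for all large $n$) and Bernoulli variables $B_{n1},\dots,B_{nn}$ with success probability $\varepsilon_n$ be jointly independent, and set $$Z_{nk}=(1-B_{nk})X_{nk}+B_{nk}Y_{nk},\qquad S_n=\sum_{k=1}^n Z_{nk}.$$ Then $X_{n1}$ and $Z_{n1}$ are square integrable for all large $n$, and, as $n\to\infty$: (i) If $\gamma_2>(2-\alpha)\gamma_1$,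 or $\gamma_2<\min\{(2-\alpha)\gamma_1,\,1-\alpha\gamma_1\}$, then $$\frac{S_n-n\mathbb E[Z_{n1}]}{\sqrt{n\operatorname{Var}(Z_{n1})}}\xrightarrow{d}\mathcal N(0,1).$$ (ii) If $\gamma_1>1/2$ and $\gamma_2\in(1-\alpha/2,\,(2-\alpha)\gamma_1)$, then $$\frac{S_n-n\mathbb E[X_{n1}]}{\sqrt{n\operatorname{Var}(X_{n1})}}\xrightarrow{d}\mathcal N(0,1).$$ (iii) If $\gamma_1>1/2$ and $\gamma_2\in(\max(1-\alpha\gamma_1,0),\,1-\alpha/2)$, then for every constant $c>0$ $$\frac{S_n-\kappa_n}{c\,n^{(1-\gamma_2)/\alpha}}\xrightarrow{d}\xi_{\alpha,c}-d,\qquad d=\begin{cases}0,&\gamma_2>1-\alpha,\\ \frac{\alpha}{1-\alpha},&\gamma_2\le 1-\alpha,\end{cases}$$ where $\xi_{\alpha,c}$ has the $\alpha$-stable distribution on $[0,\infty)$ with Lévy density $\alpha c^{-\alpha}x^{-1-\alpha}\mathbf 1\{x>0\}$, that is, the infinitely divisible law with this Lévy density, without Gaussian part and without drift: $$\mathbb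 E\,e^{iu\xi_{\alpha,c}}=\exp\Bigl(\int_0^\infty(e^{iux}-1)\,\alpha c^{-\alpha}x^{-1-\alpha}\,dx\Bigr),\qquad u\in\mathbb R,$$ and $$\kappa_n=\begin{cases} n\mathbb E[X_{n1}],&\gamma_2\in(1-\alpha,1-\alpha/2),\\ n\mathbb E[X_{n1}]+\frac{c\alpha}{1-\alpha}n^{(1-\gamma_2)/\alpha},&\gamma_2=1-\alpha,\\ \frac{c\alpha}{1-\alpha}n^{(1-\gamma_2)/\alpha},&\gamma_2\in(0,1-\alpha). \end{cases}$$ -/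

import Mathlib

open MeasureTheory ProbabilityTheory Filter Set Asymptotics
open scoped Topology NNReal ENNReal

namespace MixtureLimit

/-- `μ₁` is a probability distribution on `[0, ∞)` with exponential upper tail
`1 - F₁(x) = e^{-λ x} (1 + o(1))` as `x → +∞`. -/
structure IsLightTail (lam : ℝ) (μ₁ : Measure ℝ) : Prop where
  prob : IsProbabilityMeasure μ₁
  nonneg : μ₁ (Iio 0) = 0
  tail : (fun x : ℝ => 1 - cdf μ₁ x) ~[atTop] (fun x : ℝ => Real.exp (-(lam * x)))

/-- `μ₂` is a probability distribution on `[1, ∞)` with power upper tail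
`1 - F₂(x) = x^{-α} (1 + o(1))` as `x → +∞`. -/
structure IsHeavyTail (α : ℝ) (μ₂ : Measure ℝ) : Prop where
  prob : IsProbabilityMeasure μ₂
  one_le : μ₂ (Iio 1) = 0
  tail : (fun x : ℝ => 1 - cdf μ₂ x) ~[atTop] (fun x : ℝ => x ^ (-α))

/-- The truncation of `μ₂` at level `M`: the conditional law of `μ₂` given `(-∞, M]`, whose
distribution function is `F₂(x) / F₂(M)` for `x ≤ M` and `1` for `x > M`.
It is a probability measure as soon as `F₂(M) > 0`. -/
noncomputable def truncatedLaw (μ₂ : Measure ℝ) (M : ℝ) : Measure ℝ :=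
  ProbabilityTheory.cond μ₂ (Iic M)

/-- The mixture variable `Z = (1 - B) X + B Y`. -/
def mix {Ω : Type*} (X Y B : Ω → ℝ) (ω : Ω) : ℝ :=
  (1 - B ω) * X ω + B ω * Y ω

/-- The row sum `S_n = Z_{n,0} + ⋯ + Z_{n,n-1}`. -/
def rowSum {Ω : ℕ → Type*} (X Y B : (n : ℕ) → ℕ → Ω n → ℝ) (n : ℕ) (ω : Ω n) : ℝ :=
  ∑ k ∈ Finset.range n, mix (X n k) (Y n k) (B n k) ω

/-- The ingredients of the triangular array. Row `n` lives on its own probability space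
`(Ω n, P n)` and consists of the variables with index `k < n`: there `X n k` has law `μ₁`,
`Y n k` has law `μ₂` truncated at level `M_n = n ^ γ₁` (for all `n` for which that truncation
exists, hence for all large `n`), `B n k` is Bernoulli with success probability
`ε_n = n ^ (-γ₂)`, and all these `3 n` variables are jointly independent. -/
structure IsMixtureArray (μ₁ μ₂ : Measure ℝ) (γ₁ γ₂ : ℝ) {Ω : ℕ → Type*}
    [∀ n, MeasurableSpace (Ω n)] (P : (n : ℕ) → Measure (Ω n))
    (X Y B : (n : ℕ) → ℕ → Ω n → ℝ) : Prop where
  law_X : ∀ n, ∀ k < n, HasLaw (X n k) μ₁ (P n)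
  aemeasurable_Y : ∀ n, ∀ k < n, AEMeasurable (Y n k) (P n)
  law_Y : ∀ n : ℕ, 0 < μ₂ (Iic ((n : ℝ) ^ γ₁)) →
    ∀ k < n, HasLaw (Y n k) (truncatedLaw μ₂ ((n : ℝ) ^ γ₁)) (P n)
  aemeasurable_B : ∀ n, ∀ k < n, AEMeasurable (B n k) (P n)
  law_B_one : ∀ n : ℕ, ∀ k < n, (P n).real {ω | B n k ω = 1} = (n : ℝ) ^ (-γ₂)
  law_B_zero : ∀ n : ℕ, ∀ k < n, (P n).real {ω | B n k ω = 0} = 1 - (n : ℝ) ^ (-γ₂)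
  indep : ∀ n : ℕ, iIndepFun
    (fun i : Fin n ⊕ (Fin n ⊕ Fin n) =>
      Sum.elim (fun k : Fin n => X n k)
        (Sum.elim (fun k : Fin n => Y n k) (fun k : Fin n => B n k)) i) (P n)

/-- The law of `ξ₁ + ⋯ + ξ_n` for i.i.d. variables `ξ_i` with law `μ`. -/
noncomputable def iidSumLaw (n : ℕ) (μ : Measure ℝ) : Measure ℝ :=
  (Measure.pi (fun _ : Fin n => μ)).map (fun x => ∑ i, x i)

/-- `μ` is infinitely divisible. -/
def IsInfDivisible (μ : Measure ℝ) : Prop :=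
  ∀ n : ℕ, 1 ≤ n → ∃ ρ : Measure ℝ, IsProbabilityMeasure ρ ∧ iidSumLaw n ρ = μ

/-- `μ` is stable of index `α`: it is nondegenerate, and for i.i.d. `ξ_i` with law `μ`, the sum
`ξ₁ + ⋯ + ξ_n` has the law of `n^{1/α} ξ₁ + d_n` for some real `d_n`. -/
def IsStableLaw (α : ℝ) (μ : Measure ℝ) : Prop :=
  (∀ a : ℝ, μ ≠ Measure.dirac a) ∧
  ∀ n : ℕ, 1 ≤ n → ∃ d : ℝ, iidSumLaw n μ = μ.map (fun x => (n : ℝ) ^ (1 / α) * x + d)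

/-- `μ` has the Lévy triplet `(b, σ², ν)` with respect to the truncation function
`x 1_{|x| ≤ 1}`: `ν` is a Lévy measure and the characteristic function of `μ` is given by the
Lévy–Khintchine formula. -/
structure HasLevyTriplet (μ : Measure ℝ) (b : ℝ) (σsq : ℝ≥0) (ν : Measure ℝ) : Prop where
  levy_zero : ν {0} = 0
  levy_lt_top : ∫⁻ x, ENNReal.ofReal (min 1 (x ^ 2)) ∂ν < ∞
  charFun_eq : ∀ u : ℝ, charFun μ u =
    Complex.exp (Complex.I * u * b - σsq * (u : ℂ) ^ 2 / 2 +
      ∫ x : ℝ, (Complex.exp (Complex.I * u * x) - 1 -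
        (if |x| ≤ 1 then Complex.I * u * x else 0)) ∂ν)

/-- The measure with density `s x^{-1-α} 1_{x > 0}`. -/
noncomputable def oneSidedLevyMeasure (α s : ℝ) : Measure ℝ :=
  volume.withDensity (fun x => ENNReal.ofReal (if 0 < x then s * x ^ (-1 - α) else 0))

/-- `F` is the `α`-stable distribution on `[0, ∞)` (`0 < α < 1`) with Lévy density
`s x^{-1-α} 1_{x > 0}`, without Gaussian part and without drift. For the truncation function
`x 1_{|x| ≤ 1}`, zero drift means that the first entry of the triplet is
`∫_0^1 x · s x^{-1-α} dx = s / (1 - α)`. -/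
structure IsOneSidedStable (α s : ℝ) (F : Measure ℝ) : Prop where
  nonneg : F (Iio 0) = 0
  stable : IsStableLaw α F
  infDivisible : IsInfDivisible F
  triplet : HasLevyTriplet F (s / (1 - α)) 0 (oneSidedLevyMeasure α s)

/-- The centering `κ_n` of the stable regime; `m` stands for the mean `E[X_{n1}]`. -/
noncomputable def kappa (α γ₂ c m : ℝ) (n : ℕ) : ℝ :=
  if 1 - α < γ₂ then n * m
  else if γ₂ = 1 - α then n * m + c * α / (1 - α) * (n : ℝ) ^ ((1 - γ₂) / α)
  else c * α / (1 - α) * (n : ℝ) ^ ((1 - γ₂) / α)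

/-- The constant by which the limit in the stable regime is shifted to the left, due to the
term `c α / (1 - α) n^{(1-γ₂)/α}` in the centering. -/
noncomputable def limitShift (α γ₂ : ℝ) : ℝ :=
  if 1 - α < γ₂ then 0 else α / (1 - α)

end MixtureLimit

/-!
Each variable `Z_{nk}` has the law `(1 - ε) μ₁ + ε ν`, where `ε = n^{-γ₂}` and `ν` is `μ₂` truncated
at `n^{γ₁}` (`hasLaw_mix`), and the `Z_{nk}` of one row are independent. If `φ_n` is the
characteristic function of one centred summand, divided by the norming constant, then that of the
normalized sum is `φ_n ^ n`, up to a phase. Everything therefore reduces to the limit of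
`n (φ_n - 1)` (`IsMixtureArray.tendstoInDistribution`).

If the sums are normalized by their own mean and variance, this limit is `-u² / 2` as soon as a
Lindeberg condition holds (`tendsto_affineCharFun_of_lindeberg`). The second moment of `ν` is of
exact order `n^{(2-α)γ₁}`. If `γ₂ > (2-α)γ₁`, the contamination does not contribute to the variance
in the limit (`lindeberg_mixture_of_tendsto_zero`). If `γ₂ < (2-α)γ₁`, it dominates the variance,
and if moreover `γ₂ < 1 - αγ₁`, the truncation level is negligible with respect to the standard
deviation of the sum (`lindeberg_mixture_of_tendsto_atTop`).

Otherwise, `φ_n - 1` is split according to the two components. The component `μ₁`, centred by its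
mean, gives the Gaussian exponent times `lim n / a_n²`, where `a_n` is the norming constant. The
other one gives the limit of `∫ (e^{iux} - 1) dρ_n`, where `ρ_n` is `n ε` times the law of
`Y / a_n`. By Fubini such integrals are expressed by the tails of `ρ_n`, and since these are bounded
by `C x^{-α}` with `α < 1`, it is enough that they converge pointwise (`tendsto_integral_exp_sub_one`).
For `a_n` of order `√n` and `γ₂ > 1 - α/2` the tails tend to `0`, and the limit is normal; for
`a_n = c n^{(1-γ₂)/α}` they tend to `(c x)^{-α}`, the tail of the Lévy measure, while
`n / a_n² → 0`, and the limit is stable (`tendsto_affineCharFun_mixtureLaw`). The centring `κ_n`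
differs from `n E[X_{n1}]` by `a_n` times a sequence which converges to the shift of the limit.

The stable law is itself obtained as a limit, of the laws of `(Y_1 + ⋯ + Y_n) / (c n^{1/α})` for
independent `Y_i` with law `μ₂` (`IsHeavyTail.exists_stable`). Its stability, infinite divisibility
and Lévy triplet follow from the homogeneity of its exponent (`stableExponent_mul`) and the
compensation of the small jumps (`integral_small_jumps`).
-/

namespace MixtureLimit

/-! ### Expansion of characteristic functions and the Lindeberg term -/

lemma norm_exp_I_mul_sub_one_le (x : ℝ) : ‖Complex.exp (Complex.I * x) - 1‖ ≤ |x| := by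
  simpa using Real.norm_exp_I_mul_ofReal_sub_one_le (x := x)

lemma norm_exp_I_mul_sub_linear_le (x : ℝ) :
    ‖Complex.exp (Complex.I * x) - 1 - Complex.I * x‖ ≤ |x| ^ 2 := by
  have hd : ∀ y ∈ uIcc 0 x, HasDerivWithinAt
      (fun y : ℝ => Complex.exp (Complex.I * y) - 1 - Complex.I * y)
      (Complex.I * (Complex.exp (Complex.I * y) - 1)) (uIcc 0 x) y := by
    intro y _
    have h0 : HasDerivAt (fun y : ℝ => Complex.I * (y : ℂ)) Complex.I y := by
      simpa using (Complex.ofRealCLM.hasDerivAt (x := y)).const_mul Complex.I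
    have := (h0.cexp.sub_const 1).sub h0
    refine (this.congr_deriv ?_).hasDerivWithinAt
    ring
  have hb : ∀ y ∈ uIcc 0 x,
      ‖Complex.I * (Complex.exp (Complex.I * y) - 1)‖ ≤ |x| := by
    intro y hy
    rw [norm_mul, Complex.norm_I, one_mul]
    refine (norm_exp_I_mul_sub_one_le y).trans ?_
    simpa using abs_sub_left_of_mem_uIcc hy
  have := (convex_uIcc 0 x).norm_image_sub_le_of_norm_hasDerivWithin_le hd hb
    left_mem_uIcc right_mem_uIcc
  simpa [sq] using this

/-- The minimum makes the bound quadratic for large `x`, so that only second moments are needed, and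
cubic for small `x`. -/
lemma norm_exp_I_mul_sub_quadratic_le (x : ℝ) :
    ‖Complex.exp (Complex.I * x) - 1 - Complex.I * x + (x : ℂ) ^ 2 / 2‖ ≤
      2 * (x ^ 2 * min 1 |x|) := by
  have hd : ∀ y ∈ uIcc 0 x, HasDerivWithinAt
      (fun y : ℝ => Complex.exp (Complex.I * y) - 1 - Complex.I * y + (y : ℂ) ^ 2 / 2)
      (Complex.I * (Complex.exp (Complex.I * y) - 1 - Complex.I * y)) (uIcc 0 x) y := by
    intro y _
    have hid : HasDerivAt (fun y : ℝ => (y : ℂ)) 1 y :=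
      (hasDerivAt_id y).ofReal_comp
    have h0 : HasDerivAt (fun y : ℝ => Complex.I * (y : ℂ)) Complex.I y := by
      simpa using hid.const_mul Complex.I
    have := ((h0.cexp.sub_const 1).sub h0).add ((hid.pow 2).div_const 2)
    refine (this.congr_deriv ?_).hasDerivWithinAt
    have hI := Complex.I_mul_I
    push_cast
    linear_combination (y : ℂ) * hI
  have hb : ∀ y ∈ uIcc 0 x,
      ‖Complex.I * (Complex.exp (Complex.I * y) - 1 - Complex.I * y)‖ ≤ |x| ^ 2 := by
    intro y hy
    rw [norm_mul, Complex.norm_I, one_mul]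
    refine (norm_exp_I_mul_sub_linear_le y).trans ?_
    have : |y| ≤ |x| := by simpa using abs_sub_left_of_mem_uIcc hy
    gcongr
  have h3 := (convex_uIcc 0 x).norm_image_sub_le_of_norm_hasDerivWithin_le hd hb
    left_mem_uIcc right_mem_uIcc
  simp only [Complex.ofReal_zero, mul_zero, Complex.exp_zero, sub_self, ne_eq, OfNat.ofNat_ne_zero,
    not_false_eq_true, zero_pow, zero_div, add_zero, sub_zero, Real.norm_eq_abs, sq_abs] at h3
  rcases le_total 1 |x| with h | h
  · rw [min_eq_left h]
    refine (norm_add_le _ _).trans ?_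
    have h2 := norm_exp_I_mul_sub_linear_le x
    have : ‖(x : ℂ) ^ 2 / 2‖ = x ^ 2 / 2 := by
      rw [norm_div, norm_pow, Complex.norm_real, Real.norm_eq_abs, sq_abs]; simp
    rw [this]
    rw [sq_abs] at h2
    nlinarith [sq_nonneg x]
  · rw [min_eq_right h]
    have : 0 ≤ x ^ 2 * |x| := by positivity
    linarith

/-- The truncated second moment `∫ (z - b)² min(1, |z - b| / a)`, which controls the error in the
second order expansion of a characteristic function, as in the Lindeberg condition. -/
noncomputable def lindebergTerm (ζ : Measure ℝ) (b a : ℝ) : ℝ :=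
  ∫ z, (z - b) ^ 2 * min 1 (|z - b| / a) ∂ζ

lemma integrable_sub_sq {ζ : Measure ℝ} [IsFiniteMeasure ζ] (h2 : MemLp id 2 ζ) (b : ℝ) :
    Integrable (fun z => (z - b) ^ 2) ζ :=
  (h2.sub (memLp_const b)).integrable_sq

lemma integrable_lindeberg {ζ : Measure ℝ} [IsFiniteMeasure ζ] (h2 : MemLp id 2 ζ) (b : ℝ)
    {a : ℝ} (ha : 0 ≤ a) :
    Integrable (fun z => (z - b) ^ 2 * min 1 (|z - b| / a)) ζ := by
  refine (integrable_sub_sq h2 b).mono' (by fun_prop) (ae_of_all _ fun z => ?_)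
  have h0 : 0 ≤ min 1 (|z - b| / a) := le_min zero_le_one (by positivity)
  rw [Real.norm_eq_abs, abs_of_nonneg (by positivity)]
  exact mul_le_of_le_one_right (sq_nonneg _) (min_le_left _ _)

lemma min_one_mul_le {u x : ℝ} (hx : 0 ≤ x) :
    min 1 (|u| * x) ≤ max 1 |u| * min 1 x := by
  rcases le_total 1 x with h | h
  · rw [min_eq_left h, mul_one]
    exact (min_le_left _ _).trans (le_max_left _ _)
  · rw [min_eq_right h]
    exact (min_le_right _ _).trans (by gcongr; exact le_max_right _ _)

/-- Second order expansion of the characteristic function of a centred variable, with the error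
expressed by `lindebergTerm`. -/
lemma norm_integral_exp_sub_le {ζ : Measure ℝ} [IsProbabilityMeasure ζ] (h2 : MemLp id 2 ζ)
    {b a : ℝ} (hb : b = ∫ z, z ∂ζ) (ha : 0 < a) (u : ℝ) :
    ‖(∫ z, Complex.exp (Complex.I * ((u * ((z - b) / a) : ℝ) : ℂ)) ∂ζ) - 1
        + ((u ^ 2 / (2 * a ^ 2) * ∫ z, (z - b) ^ 2 ∂ζ : ℝ) : ℂ)‖ ≤
      2 * (u ^ 2 / a ^ 2) * max 1 |u| * lindebergTerm ζ b a := by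
  have hint : Integrable (fun z : ℝ => z) ζ := h2.integrable (by norm_num)
  have hsq := integrable_sub_sq h2 b
  have hexp : Integrable
      (fun z : ℝ => Complex.exp (Complex.I * ((u * ((z - b) / a) : ℝ) : ℂ))) ζ := by
    refine Integrable.of_bound (by fun_prop) 1 (ae_of_all _ fun z => ?_)
    rw [Complex.norm_exp_I_mul_ofReal]
  have hlin : Integrable (fun z : ℝ => ((u * ((z - b) / a) : ℝ) : ℂ)) ζ :=
    (((hint.sub (integrable_const b)).div_const a).const_mul u).ofReal
  have hlin0 : ∫ z : ℝ, ((u * ((z - b) / a) : ℝ) : ℂ) ∂ζ = 0 := by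
    rw [integral_complex_ofReal, integral_const_mul, integral_div,
      integral_sub hint (integrable_const b)]
    simp [hb]
  have hquad : Integrable (fun z : ℝ => ((u * ((z - b) / a) : ℝ) : ℂ) ^ 2 / 2) ζ := by
    have : Integrable (fun z : ℝ => (((u ^ 2 / a ^ 2 * (z - b) ^ 2) : ℝ) : ℂ) / 2) ζ :=
      ((hsq.const_mul _).ofReal).div_const 2
    refine this.congr (ae_of_all _ fun z => ?_)
    push_cast
    field_simp
  have hquad0 : ∫ z : ℝ, ((u * ((z - b) / a) : ℝ) : ℂ) ^ 2 / 2 ∂ζ =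
      ((u ^ 2 / (2 * a ^ 2) * ∫ z, (z - b) ^ 2 ∂ζ : ℝ) : ℂ) := by
    rw [← integral_const_mul, ← integral_complex_ofReal]
    congr 1
    ext z
    push_cast
    field_simp
  have key : (∫ z, Complex.exp (Complex.I * ((u * ((z - b) / a) : ℝ) : ℂ)) ∂ζ) - 1
        + ((u ^ 2 / (2 * a ^ 2) * ∫ z, (z - b) ^ 2 ∂ζ : ℝ) : ℂ) =
      ∫ z : ℝ, (Complex.exp (Complex.I * ((u * ((z - b) / a) : ℝ) : ℂ)) - 1
        - Complex.I * ((u * ((z - b) / a) : ℝ) : ℂ)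
        + ((u * ((z - b) / a) : ℝ) : ℂ) ^ 2 / 2) ∂ζ := by
    have h1 : Integrable
        (fun z : ℝ => Complex.exp (Complex.I * ((u * ((z - b) / a) : ℝ) : ℂ)) - 1) ζ :=
      hexp.sub (integrable_const 1)
    have h2 : Integrable
        (fun z : ℝ => Complex.exp (Complex.I * ((u * ((z - b) / a) : ℝ) : ℂ)) - 1
          - Complex.I * ((u * ((z - b) / a) : ℝ) : ℂ)) ζ := h1.sub (hlin.const_mul _)
    rw [integral_add h2 hquad, hquad0, integral_sub h1 (hlin.const_mul _),
      integral_sub hexp (integrable_const 1), integral_const_mul, hlin0]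
    simp
  rw [key, lindebergTerm, ← integral_const_mul]
  refine norm_integral_le_of_norm_le ((integrable_lindeberg h2 b ha.le).const_mul _)
    (ae_of_all _ fun z => (norm_exp_I_mul_sub_quadratic_le _).trans ?_)
  have h1 : |u * ((z - b) / a)| = |u| * (|z - b| / a) := by
    rw [abs_mul, abs_div, abs_of_pos ha]
  have h3 : (u * ((z - b) / a)) ^ 2 = u ^ 2 / a ^ 2 * (z - b) ^ 2 := by
    field_simp
  rw [h1, h3]
  have := min_one_mul_le (u := u) (x := |z - b| / a) (by positivity)
  calc 2 * (u ^ 2 / a ^ 2 * (z - b) ^ 2 * min 1 (|u| * (|z - b| / a)))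
      ≤ 2 * (u ^ 2 / a ^ 2 * (z - b) ^ 2 * (max 1 |u| * min 1 (|z - b| / a))) := by gcongr
    _ = _ := by ring

/-- For a fixed square integrable law, the Lindeberg term vanishes as the scale tends to infinity,
uniformly over bounded centrings. -/
lemma tendsto_lindebergTerm {ζ : Measure ℝ} [IsFiniteMeasure ζ] (h2 : MemLp id 2 ζ)
    {b a : ℕ → ℝ} {C : ℝ} (hb : ∀ᶠ n in atTop, |b n| ≤ C) (ha : Tendsto a atTop atTop) :
    Tendsto (fun n => lindebergTerm ζ (b n) (a n)) atTop (𝓝 0) := by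
  have hz : Integrable (fun z : ℝ => z ^ 2) ζ := h2.integrable_sq
  rw [← integral_zero ℝ ℝ (μ := ζ)]
  refine tendsto_integral_filter_of_dominated_convergence (fun z => 2 * z ^ 2 + 2 * C ^ 2)
    (Eventually.of_forall fun n => by fun_prop) ?_
    ((hz.const_mul 2).add (integrable_const _)) (ae_of_all _ fun z => ?_)
  · filter_upwards [hb, ha.eventually_ge_atTop 0] with n hn hn0
    refine ae_of_all _ fun z => ?_
    have h0 : 0 ≤ min 1 (|z - b n| / a n) := le_min zero_le_one (by positivity)
    rw [Real.norm_eq_abs, abs_of_nonneg (by positivity)]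
    refine (mul_le_of_le_one_right (sq_nonneg _) (min_le_left _ _)).trans ?_
    have : b n ^ 2 ≤ C ^ 2 := sq_le_sq' (by linarith [(abs_le.1 hn).1]) (abs_le.1 hn).2
    nlinarith [sq_nonneg (z + b n)]
  · have hlim : Tendsto (fun n => (|z| + C) ^ 2 * ((|z| + C) / a n)) atTop (𝓝 0) := by
      simpa using (ha.const_div_atTop (|z| + C)).const_mul ((|z| + C) ^ 2)
    refine squeeze_zero' ?_ ?_ hlim
    · filter_upwards [ha.eventually_ge_atTop 0] with n hn0
      have h0 : 0 ≤ min 1 (|z - b n| / a n) := le_min zero_le_one (by positivity)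
      positivity
    · filter_upwards [hb, ha.eventually_ge_atTop 0] with n hn hn0
      have h1 : |z - b n| ≤ |z| + C := (abs_sub _ _).trans (by linarith)
      have h0 : 0 ≤ min 1 (|z - b n| / a n) := le_min zero_le_one (by positivity)
      rw [← sq_abs (z - b n)]
      gcongr
      exact (min_le_right _ _).trans (by gcongr)

/-! ### Measures with power tails -/

/-- `ρ` lives on `(0, ∞)` and its tails satisfy `ρ (x, ∞) ≤ C x^{-α}`. -/
structure HasPowerTail (α C : ℝ) (ρ : Measure ℝ) : Prop where
  sfinite : SFinite ρ
  pos : ρ (Iic 0) = 0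
  tail_le : ∀ x, 0 < x → ρ (Ioi x) ≤ ENNReal.ofReal (C * x ^ (-α))

lemma HasPowerTail.real_le {α C : ℝ} {ρ : Measure ℝ} (h : HasPowerTail α C ρ) (hC : 0 ≤ C)
    {x : ℝ} (hx : 0 < x) : ρ.real (Ioi x) ≤ C * x ^ (-α) :=
  ENNReal.toReal_le_of_le_ofReal (by positivity) (h.tail_le x hx)

lemma integrableOn_Ioc_rpow_neg {α : ℝ} (hα : α < 1) (C K : ℝ) :
    IntegrableOn (fun v : ℝ => C * v ^ (-α)) (Ioc 0 K) := by
  rcases le_total 0 K with hK | hK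
  · rw [← intervalIntegrable_iff_integrableOn_Ioc_of_le hK]
    exact (intervalIntegral.intervalIntegrable_rpow' (by linarith)).const_mul C
  · simp [Ioc_eq_empty_of_le hK]

lemma HasPowerTail.lintegral_lt_top {α C : ℝ} (hα : α < 1) {ρ : Measure ℝ}
    (h : HasPowerTail α C ρ) (K : ℝ) : ∫⁻ v in Ioc 0 K, ρ (Ioi v) < ∞ := by
  refine lt_of_le_of_lt ?_ (integrableOn_Ioc_rpow_neg hα C K).lintegral_lt_top
  exact setLIntegral_mono' measurableSet_Ioc fun v hv => h.tail_le v hv.1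

/-- Fubini: the part of `e^{iux} - 1` accumulated up to level `K`, integrated against `ρ`, is an
integral over the tails of `ρ`. -/
lemma integral_exp_min_sub_one {ρ : Measure ℝ} [SFinite ρ] (hpos : ρ (Iic 0) = 0)
    {K : ℝ} (hK : 0 < K) (hfin : ∫⁻ v in Ioc 0 K, ρ (Ioi v) < ∞) (u : ℝ) :
    Integrable (fun x : ℝ => Complex.exp (Complex.I * ((u * min x K : ℝ) : ℂ)) - 1) ρ ∧
    ∫ x, (Complex.exp (Complex.I * ((u * min x K : ℝ) : ℂ)) - 1) ∂ρ =
      ∫ v in Ioc 0 K, (ρ.real (Ioi v) : ℂ) *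
        (Complex.I * u * Complex.exp (Complex.I * ((u * v : ℝ) : ℂ))) := by
  set g : ℝ → ℂ := fun v => Complex.I * u * Complex.exp (Complex.I * ((u * v : ℝ) : ℂ)) with hg
  have hgc : Continuous g := by fun_prop
  have hgn : ∀ v, ‖g v‖ = |u| := fun v => by
    rw [hg]; simp only [norm_mul, Complex.norm_I, Complex.norm_exp_I_mul_ofReal]; simp
  have hderiv : ∀ v : ℝ, HasDerivAt
      (fun v : ℝ => Complex.exp (Complex.I * ((u * v : ℝ) : ℂ)) - 1) (g v) v := by
    intro v
    have h0 : HasDerivAt (fun v : ℝ => Complex.I * ((u * v : ℝ) : ℂ)) (Complex.I * u) v := by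
      have := (((hasDerivAt_id v).const_mul u).ofReal_comp).const_mul Complex.I
      simpa using this
    refine (h0.cexp.sub_const 1).congr_deriv ?_
    rw [hg]; ring
  -- the strict inequality `v < x` gives the tails `ρ (v, ∞)` after the swap of the integrals
  have hFTC : ∀ x : ℝ, 0 < x → ∫ v in Ioc 0 K, (Iio x).indicator g v =
      Complex.exp (Complex.I * ((u * min x K : ℝ) : ℂ)) - 1 := by
    intro x hx
    have hm : 0 ≤ min x K := le_min hx.le hK.le
    have h1 : ∫ v in (0 : ℝ)..(min x K), g v =
        Complex.exp (Complex.I * ((u * min x K : ℝ) : ℂ)) - 1 := by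
      rw [intervalIntegral.integral_eq_sub_of_hasDerivAt (fun v _ => hderiv v)
        (hgc.intervalIntegrable _ _)]
      simp
    rw [← h1, intervalIntegral.integral_of_le hm, integral_indicator measurableSet_Iio,
      Measure.restrict_restrict measurableSet_Iio]
    refine setIntegral_congr_set ?_
    have : (Ioc 0 (min x K) : Set ℝ) \ {x} ⊆ Iio x ∩ Ioc 0 K := by
      rintro v ⟨⟨h1, h2⟩, h3⟩
      exact ⟨lt_of_le_of_ne (h2.trans (min_le_left _ _)) h3, h1, h2.trans (min_le_right _ _)⟩
    have h4 : Iio x ∩ Ioc 0 K ⊆ Ioc 0 (min x K) := fun v hv =>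
      ⟨hv.2.1, le_min (le_of_lt hv.1) hv.2.2⟩
    refine (LE.le.eventuallyLE h4).antisymm ?_
    refine (sdiff_null_ae_eq_self (s := Ioc 0 (min x K)) (t := {x}) (by simp)).symm.le.trans ?_
    exact LE.le.eventuallyLE this
  have hjm : Measurable (fun p : ℝ × ℝ => (Iio p.1).indicator g p.2) := by
    have : (fun p : ℝ × ℝ => (Iio p.1).indicator g p.2) =
        {p : ℝ × ℝ | p.2 < p.1}.indicator (fun p => g p.2) := by
      ext p; simp [indicator]
    rw [this]
    exact (hgc.measurable.comp measurable_snd).indicator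
      (measurableSet_lt measurable_snd measurable_fst)
  have hint : Integrable (fun p : ℝ × ℝ => (Iio p.1).indicator g p.2)
      (ρ.prod (volume.restrict (Ioc 0 K))) := by
    refine ⟨hjm.aestronglyMeasurable, ?_⟩
    rw [hasFiniteIntegral_iff_enorm, lintegral_prod_symm _ (hjm.enorm.aemeasurable)]
    have : ∀ v, ∫⁻ x, ‖(Iio x).indicator g v‖ₑ ∂ρ = ENNReal.ofReal |u| * ρ (Ioi v) := by
      intro v
      have : (fun x => ‖(Iio x).indicator g v‖ₑ) =
          (Ioi v).indicator (fun _ => ENNReal.ofReal |u|) := by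
        ext x
        by_cases h : v < x
        · simp [indicator, h, ← ofReal_norm, hgn]
        · simp [indicator, h]
      rw [this, lintegral_indicator_const measurableSet_Ioi]
    simp_rw [this]
    rw [lintegral_const_mul' _ _ ENNReal.ofReal_ne_top]
    exact ENNReal.mul_lt_top ENNReal.ofReal_lt_top hfin
  have hae : ∀ᵐ x ∂ρ, 0 < x := by
    rw [ae_iff]; simpa [Iic_def] using hpos
  have hcongr : (fun x => ∫ v in Ioc 0 K, (Iio x).indicator g v) =ᵐ[ρ]
      fun x => Complex.exp (Complex.I * ((u * min x K : ℝ) : ℂ)) - 1 := by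
    filter_upwards [hae] with x hx using hFTC x hx
  refine ⟨hint.integral_prod_left.congr hcongr, ?_⟩
  rw [← integral_congr_ae hcongr, integral_integral_swap hint]
  refine integral_congr_ae (ae_of_all _ fun v => ?_)
  have : (fun x => (Iio x).indicator g v) = (Ioi v).indicator (fun _ => g v) := by
    ext x; simp [indicator]
  simp only [this]
  rw [integral_indicator_const _ measurableSet_Ioi, Complex.real_smul]

/-- Above the level `K`, the function `e^{iux} - 1` differs from its value at `K` by at most `2`, so
its integral is the one over the tails up to `K`, except for an error of `2 ρ (K, ∞)`. -/
lemma HasPowerTail.integrable_exp_sub_one {α C : ℝ} (hα : α < 1) {ρ : Measure ℝ}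
    (h : HasPowerTail α C ρ) (u : ℝ) :
    Integrable (fun x : ℝ => Complex.exp (Complex.I * ((u * x : ℝ) : ℂ)) - 1) ρ ∧
    ∀ K, 0 < K → ‖(∫ x, (Complex.exp (Complex.I * ((u * x : ℝ) : ℂ)) - 1) ∂ρ) -
      ∫ v in Ioc 0 K, (ρ.real (Ioi v) : ℂ) *
        (Complex.I * u * Complex.exp (Complex.I * ((u * v : ℝ) : ℂ)))‖ ≤
      2 * ρ.real (Ioi K) := by
  have := h.sfinite
  have hsplit : ∀ K, 0 < K →
      Integrable ((Ioi K).indicator (fun x : ℝ => Complex.exp (Complex.I * ((u * x : ℝ) : ℂ)) -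
        Complex.exp (Complex.I * ((u * K : ℝ) : ℂ)))) ρ := by
    intro K hK
    rw [integrable_indicator_iff measurableSet_Ioi]
    refine Measure.integrableOn_of_bounded (M := 2)
      ((h.tail_le K hK).trans_lt ENNReal.ofReal_lt_top).ne (by fun_prop) (ae_of_all _ fun x => ?_)
    refine (norm_sub_le _ _).trans ?_
    rw [Complex.norm_exp_I_mul_ofReal, Complex.norm_exp_I_mul_ofReal]
    norm_num
  have heq : ∀ K : ℝ, (fun x : ℝ => Complex.exp (Complex.I * ((u * x : ℝ) : ℂ)) - 1) =
      fun x => (Complex.exp (Complex.I * ((u * min x K : ℝ) : ℂ)) - 1) +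
        (Ioi K).indicator (fun x : ℝ => Complex.exp (Complex.I * ((u * x : ℝ) : ℂ)) -
          Complex.exp (Complex.I * ((u * K : ℝ) : ℂ))) x := by
    intro K
    ext x
    rcases le_or_gt x K with hx | hx
    · rw [min_eq_left hx, indicator_of_notMem (by simpa using hx), add_zero]
    · rw [min_eq_right hx.le, indicator_of_mem (by simpa using hx)]; ring
  have hF := fun K (hK : 0 < K) => integral_exp_min_sub_one h.pos hK (h.lintegral_lt_top hα K) u
  refine ⟨?_, fun K hK => ?_⟩
  · rw [heq 1]
    exact (hF 1 one_pos).1.add (hsplit 1 one_pos)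
  · rw [heq K, integral_add (hF K hK).1 (hsplit K hK), (hF K hK).2, add_sub_cancel_left,
      integral_indicator measurableSet_Ioi]
    refine norm_setIntegral_le_of_norm_le_const
      ((h.tail_le K hK).trans_lt ENNReal.ofReal_lt_top) fun x _ => ?_
    refine (norm_sub_le _ _).trans ?_
    rw [Complex.norm_exp_I_mul_ofReal, Complex.norm_exp_I_mul_ofReal]
    norm_num

/-- Under a common power bound with exponent `α < 1`, pointwise convergence of the tails implies
convergence of the integrals of `e^{iux} - 1`. -/
lemma tendsto_integral_exp_sub_one {α C : ℝ} (hα : α ∈ Ioo (0 : ℝ) 1) (hC : 0 ≤ C)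
    {ρ : ℕ → Measure ℝ} {ρ₀ : Measure ℝ} (h : ∀ᶠ n in atTop, HasPowerTail α C (ρ n))
    (h₀ : HasPowerTail α C ρ₀)
    (hlim : ∀ x, 0 < x → Tendsto (fun n => (ρ n).real (Ioi x)) atTop (𝓝 (ρ₀.real (Ioi x))))
    (u : ℝ) :
    Tendsto (fun n => ∫ x, (Complex.exp (Complex.I * ((u * x : ℝ) : ℂ)) - 1) ∂(ρ n)) atTop
      (𝓝 (∫ x, (Complex.exp (Complex.I * ((u * x : ℝ) : ℂ)) - 1) ∂ρ₀)) := by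
  have hJ : ∀ K : ℝ, Tendsto (fun n => ∫ v in Ioc 0 K, ((ρ n).real (Ioi v) : ℂ) *
        (Complex.I * u * Complex.exp (Complex.I * ((u * v : ℝ) : ℂ)))) atTop
      (𝓝 (∫ v in Ioc 0 K, (ρ₀.real (Ioi v) : ℂ) *
        (Complex.I * u * Complex.exp (Complex.I * ((u * v : ℝ) : ℂ))))) := by
    intro K
    refine tendsto_integral_filter_of_dominated_convergence (fun v => C * v ^ (-α) * |u|) ?_ ?_
      ((integrableOn_Ioc_rpow_neg hα.2 C K).mul_const _) ?_
    · filter_upwards [h] with n hn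
      have hanti : AntitoneOn (fun v => (ρ n).real (Ioi v)) (Ioc 0 K) := fun x hx y _ hxy =>
        measureReal_mono (Ioi_subset_Ioi hxy)
          ((hn.tail_le x hx.1).trans_lt ENNReal.ofReal_lt_top).ne
      have := aemeasurable_restrict_of_antitoneOn (μ := volume) measurableSet_Ioc hanti
      refine AEMeasurable.aestronglyMeasurable (AEMeasurable.mul ?_ (by fun_prop))
      exact Complex.measurable_ofReal.comp_aemeasurable this
    · filter_upwards [h] with n hn
      filter_upwards [ae_restrict_mem measurableSet_Ioc] with v hv
      simp only [norm_mul, Complex.norm_I, Complex.norm_exp_I_mul_ofReal, Complex.norm_real,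
        Real.norm_eq_abs, one_mul, mul_one, abs_of_nonneg measureReal_nonneg]
      gcongr
      exact hn.real_le hC hv.1
    · filter_upwards [ae_restrict_mem measurableSet_Ioc] with v hv
      exact ((Complex.continuous_ofReal.tendsto _).comp (hlim v hv.1)).mul_const _
  -- dominated convergence handles `(0, K]` for each `K`; a large `K` makes the rest uniformly small
  have hKlim : Tendsto (fun K : ℝ => C * K ^ (-α)) atTop (𝓝 0) := by
    simpa using (tendsto_rpow_neg_atTop hα.1).const_mul C
  rw [Metric.tendsto_nhds]
  intro ε hε
  obtain ⟨K, hK1, hK0⟩ := ((hKlim.eventually (gt_mem_nhds (show 0 < ε / 8 by positivity))).and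
    (eventually_gt_atTop 0)).exists
  filter_upwards [h, Metric.tendsto_nhds.1 (hJ K) (ε / 4) (by positivity)] with n hn hn2
  have h1 := (hn.integrable_exp_sub_one hα.2 u).2 K hK0
  have h2 := (h₀.integrable_exp_sub_one hα.2 u).2 K hK0
  have h3 := hn.real_le hC hK0
  have h4 := h₀.real_le hC hK0
  rw [dist_eq_norm] at hn2 ⊢
  rw [← norm_neg, neg_sub] at h2
  have := norm_add₃_le.trans (add_le_add_three h1 hn2.le h2)
  refine lt_of_eq_of_lt (congrArg norm ?_) (this.trans_lt (by linarith))
  ring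

/-! ### The one-sided stable law -/

lemma oneSidedLevyMeasure_eq (α s : ℝ) : oneSidedLevyMeasure α s =
    (volume.restrict (Ioi 0)).withDensity (fun x => ENNReal.ofReal (s * x ^ (-1 - α))) := by
  rw [oneSidedLevyMeasure, ← withDensity_indicator measurableSet_Ioi]
  congr 1
  ext x
  by_cases h : 0 < x <;> simp [h]

lemma integral_oneSidedLevyMeasure {α s : ℝ} (hs : 0 ≤ s) (f : ℝ → ℂ) :
    ∫ x, f x ∂(oneSidedLevyMeasure α s) = ∫ x in Ioi 0, ((s * x ^ (-1 - α) : ℝ) : ℂ) * f x := by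
  rw [oneSidedLevyMeasure_eq, integral_withDensity_eq_integral_toReal_smul (by fun_prop)
    (by simp)]
  refine setIntegral_congr_fun measurableSet_Ioi fun x hx => ?_
  have hx : 0 < x := hx
  rw [ENNReal.toReal_ofReal (by positivity), Complex.real_smul]

lemma integrable_oneSidedLevyMeasure {α s : ℝ} (hs : 0 ≤ s) {f : ℝ → ℂ} :
    Integrable f (oneSidedLevyMeasure α s) ↔
      IntegrableOn (fun x => ((s * x ^ (-1 - α) : ℝ) : ℂ) * f x) (Ioi 0) := by
  rw [oneSidedLevyMeasure_eq, integrable_withDensity_iff_integrable_smul' (by fun_prop)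
    (by simp)]
  refine integrable_congr ?_
  filter_upwards [ae_restrict_mem measurableSet_Ioi] with x hx
  have hx : 0 < x := hx
  rw [ENNReal.toReal_ofReal (by positivity), Complex.real_smul]

lemma oneSidedLevyMeasure_Iic (α s : ℝ) : oneSidedLevyMeasure α s (Iic 0) = 0 := by
  rw [oneSidedLevyMeasure_eq]
  refine withDensity_absolutelyContinuous _ _ ?_
  rw [Measure.restrict_apply measurableSet_Iic, Iic_inter_Ioi, Ioc_self, measure_empty]

lemma oneSidedLevyMeasure_Ioi {α s : ℝ} (hα : 0 < α) (hs : 0 ≤ s) {x : ℝ} (hx : 0 < x) :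
    oneSidedLevyMeasure α s (Ioi x) = ENNReal.ofReal (s / α * x ^ (-α)) := by
  rw [oneSidedLevyMeasure_eq, withDensity_apply _ measurableSet_Ioi,
    Measure.restrict_restrict measurableSet_Ioi, Ioi_inter_Ioi, sup_eq_left.2 hx.le,
    ← ofReal_integral_eq_lintegral_ofReal]
  · rw [integral_const_mul, integral_Ioi_rpow_of_lt (by linarith) hx]
    congr 1
    rw [show -1 - α + 1 = -α by ring]
    field_simp
  · exact (integrableOn_Ioi_rpow_of_lt (by linarith) hx).const_mul s
  · filter_upwards [ae_restrict_mem measurableSet_Ioi] with y hy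
    have : 0 < y := hx.trans hy
    positivity

lemma hasPowerTail_oneSidedLevyMeasure {α s : ℝ} (hα : 0 < α) (hs : 0 ≤ s) :
    HasPowerTail α (s / α) (oneSidedLevyMeasure α s) where
  sfinite := by rw [oneSidedLevyMeasure_eq]; infer_instance
  pos := oneSidedLevyMeasure_Iic α s
  tail_le x hx := (oneSidedLevyMeasure_Ioi hα hs hx).le

/-- The exponent `∫ (e^{iux} - 1) s x^{-1-α} dx` over `x > 0` of the one-sided stable law. -/
noncomputable def stableExponent (α s u : ℝ) : ℂ :=
  ∫ x, (Complex.exp (Complex.I * ((u * x : ℝ) : ℂ)) - 1) ∂(oneSidedLevyMeasure α s)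

/-- Homogeneity of degree `α`, the analytic form of stability. -/
lemma stableExponent_mul {α s : ℝ} (hs : 0 ≤ s) {k : ℝ} (hk : 0 < k) (u : ℝ) :
    stableExponent α s (k * u) = ((k ^ α : ℝ) : ℂ) * stableExponent α s u := by
  rw [stableExponent, stableExponent, integral_oneSidedLevyMeasure hs,
    integral_oneSidedLevyMeasure hs]
  have := integral_comp_mul_left_Ioi
    (fun x => ((s * x ^ (-1 - α) : ℝ) : ℂ) *
      (Complex.exp (Complex.I * ((u * x : ℝ) : ℂ)) - 1)) 0 hk
  rw [mul_zero] at this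
  have h2 : ∫ x in Ioi (0 : ℝ), ((s * x ^ (-1 - α) : ℝ) : ℂ) *
      (Complex.exp (Complex.I * ((k * u * x : ℝ) : ℂ)) - 1) =
      ((k ^ (1 + α) : ℝ) : ℂ) * ∫ x in Ioi (0 : ℝ), ((s * (k * x) ^ (-1 - α) : ℝ) : ℂ) *
      (Complex.exp (Complex.I * ((u * (k * x) : ℝ) : ℂ)) - 1) := by
    rw [← integral_const_mul]
    refine setIntegral_congr_fun measurableSet_Ioi fun x hx => ?_
    have hx : 0 < x := hx
    have h3 : s * x ^ (-1 - α) = k ^ (1 + α) * (s * (k * x) ^ (-1 - α)) := by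
      rw [Real.mul_rpow hk.le hx.le]
      have : k ^ (1 + α) * k ^ (-1 - α) = 1 := by
        rw [← Real.rpow_add hk]; ring_nf; exact Real.rpow_zero k
      linear_combination (-(s * x ^ (-1 - α))) * this
    rw [h3, show k * u * x = u * (k * x) by ring]
    push_cast
    ring
  rw [h2, this, Complex.real_smul, ← mul_assoc]
  congr 1
  rw [← Complex.ofReal_mul]
  congr 1
  rw [Real.rpow_add hk, Real.rpow_one]
  field_simp

lemma stableExponent_zero (α s : ℝ) : stableExponent α s 0 = 0 := by
  simp [stableExponent]

lemma continuousAt_stableExponent {α s : ℝ} (hα : 0 < α) (hs : 0 ≤ s) :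
    ContinuousAt (stableExponent α s) 0 := by
  rw [ContinuousAt, stableExponent_zero]
  refine squeeze_zero_norm
    (a := fun u => |u| ^ α * (‖stableExponent α s 1‖ + ‖stableExponent α s (-1)‖)) ?_ ?_
  · intro u
    rcases lt_trichotomy u 0 with h | h | h
    · have := stableExponent_mul (α := α) hs (neg_pos.2 h) (-1)
      rw [show -u * -1 = u by ring] at this
      rw [this, norm_mul, Complex.norm_real, abs_of_neg h, Real.norm_eq_abs,
        abs_of_pos (Real.rpow_pos_of_pos (neg_pos.2 h) α)]
      have := Real.rpow_pos_of_pos (neg_pos.2 h) α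
      gcongr
      linarith [norm_nonneg (stableExponent α s 1)]
    · subst h; rw [stableExponent_zero, norm_zero]; positivity
    · have := stableExponent_mul (α := α) hs h 1
      rw [mul_one] at this
      rw [this, norm_mul, Complex.norm_real, abs_of_pos h, Real.norm_eq_abs,
        abs_of_pos (Real.rpow_pos_of_pos h α)]
      gcongr
      linarith [norm_nonneg (stableExponent α s (-1))]
  · have : Tendsto (fun u : ℝ => |u| ^ α) (𝓝 0) (𝓝 0) := by
      have h := (Real.continuous_rpow_const hα.le).comp continuous_abs
      have := h.tendsto 0
      simpa [Function.comp_def, Real.zero_rpow hα.ne'] using this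
    simpa using this.mul_const (‖stableExponent α s 1‖ + ‖stableExponent α s (-1)‖)

/-- This makes the modulus of the characteristic function less than `1`, so that the stable law is
not degenerate. -/
lemma re_stableExponent_one_neg {α s : ℝ} (hα : α ∈ Ioo (0 : ℝ) 1) (hs : 0 < s) :
    (stableExponent α s 1).re < 0 := by
  have hint := ((hasPowerTail_oneSidedLevyMeasure hα.1 hs.le).integrable_exp_sub_one hα.2 1).1
  rw [integrable_oneSidedLevyMeasure hs.le] at hint
  have hre : (stableExponent α s 1).re =
      - ∫ x in Ioi (0 : ℝ), s * x ^ (-1 - α) * (1 - Real.cos x) := by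
    rw [stableExponent, integral_oneSidedLevyMeasure hs.le, ← integral_neg,
      ← RCLike.re_eq_complex_re, ← integral_re hint]
    refine setIntegral_congr_fun measurableSet_Ioi fun x _ => ?_
    simp only [RCLike.re_eq_complex_re, Complex.re_ofReal_mul, one_mul, Complex.sub_re,
      Complex.one_re]
    rw [mul_comm Complex.I, Complex.exp_ofReal_mul_I_re]
    ring
  have hint2 : IntegrableOn (fun x : ℝ => s * x ^ (-1 - α) * (1 - Real.cos x)) (Ioi 0) := by
    refine IntegrableOn.congr_fun (hint.re.neg) (fun x _ => ?_) measurableSet_Ioi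
    simp only [Pi.neg_apply, RCLike.re_eq_complex_re, Complex.re_ofReal_mul, one_mul,
      Complex.sub_re, Complex.one_re]
    rw [mul_comm Complex.I, Complex.exp_ofReal_mul_I_re]
    ring
  rw [hre, neg_lt_zero, setIntegral_pos_iff_support_of_nonneg_ae _ hint2]
  · refine lt_of_lt_of_le (b := volume (Ioo (0 : ℝ) 1)) (by simp) (measure_mono fun x hx => ?_)
    refine ⟨?_, hx.1⟩
    have h1 : Real.cos x < 1 := by
      have := Real.cos_lt_cos_of_nonneg_of_le_pi le_rfl
        (by linarith [hx.2, Real.pi_gt_three]) hx.1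
      simpa using this
    have : 0 < x ^ (-1 - α) := Real.rpow_pos_of_pos hx.1 _
    rw [Function.mem_support]
    have : 0 < s * x ^ (-1 - α) * (1 - Real.cos x) := by
      have : 0 < 1 - Real.cos x := by linarith
      positivity
    exact this.ne'
  · filter_upwards [ae_restrict_mem measurableSet_Ioi] with x hx
    have hx : 0 < x := hx
    have : 0 ≤ 1 - Real.cos x := by linarith [Real.cos_le_one x]
    simp only [Pi.zero_apply]
    positivity

/-- The compensator: `∫_0^1 x · s x^{-1-α} dx = s / (1 - α)`. -/
lemma integral_small_jumps {α s : ℝ} (hα : α < 1) (hs : 0 ≤ s) (u : ℝ) :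
    Integrable (fun x : ℝ => if |x| ≤ 1 then Complex.I * u * x else 0)
      (oneSidedLevyMeasure α s) ∧
    ∫ x : ℝ, (if |x| ≤ 1 then Complex.I * u * x else 0) ∂(oneSidedLevyMeasure α s) =
      Complex.I * u * ((s / (1 - α) : ℝ) : ℂ) := by
  have heq : ∀ x ∈ Ioi (0 : ℝ), ((s * x ^ (-1 - α) : ℝ) : ℂ) *
      (if |x| ≤ 1 then Complex.I * u * x else 0) =
      (Iic 1).indicator (fun x : ℝ => Complex.I * u * ((s * x ^ (-α) : ℝ) : ℂ)) x := by
    intro x hx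
    have hx : 0 < x := hx
    rw [abs_of_pos hx]
    by_cases h : x ≤ 1
    · rw [if_pos h, indicator_of_mem (by simpa using h)]
      have : x ^ (-α) = x ^ (-1 - α) * x := by
        rw [← Real.rpow_add_one hx.ne']; ring_nf
      rw [this]
      push_cast
      ring
    · rw [if_neg h, indicator_of_notMem (by simpa using h), mul_zero]
  have hI : IntegrableOn (fun x : ℝ => Complex.I * u * ((s * x ^ (-α) : ℝ) : ℂ)) (Ioc 0 1) :=
    ((integrableOn_Ioc_rpow_neg hα s 1).ofReal).const_mul _
  constructor
  · rw [integrable_oneSidedLevyMeasure hs]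
    refine IntegrableOn.congr_fun ?_ (fun x hx => (heq x hx).symm) measurableSet_Ioi
    rw [IntegrableOn, integrable_indicator_iff measurableSet_Iic, IntegrableOn,
      Measure.restrict_restrict measurableSet_Iic, Iic_inter_Ioi]
    exact hI
  · rw [integral_oneSidedLevyMeasure hs, setIntegral_congr_fun measurableSet_Ioi heq,
      integral_indicator measurableSet_Iic, Measure.restrict_restrict measurableSet_Iic,
      Iic_inter_Ioi, integral_const_mul, integral_complex_ofReal, integral_const_mul,
      ← intervalIntegral.integral_of_le zero_le_one, integral_rpow (Or.inl (by linarith))]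
    rw [Real.one_rpow, Real.zero_rpow (by linarith)]
    congr 2
    rw [show -α + 1 = 1 - α by ring]
    field_simp
    ring

lemma lintegral_min_one_sq_oneSidedLevyMeasure {α s : ℝ} (hα : α ∈ Ioo (0 : ℝ) 1) (hs : 0 ≤ s) :
    ∫⁻ x, ENNReal.ofReal (min 1 (x ^ 2)) ∂(oneSidedLevyMeasure α s) < ∞ := by
  have h1 := (integral_small_jumps hα.2 hs 1).1.hasFiniteIntegral
  rw [hasFiniteIntegral_iff_enorm] at h1
  have hle : ∀ x : ℝ, ENNReal.ofReal (min 1 (x ^ 2)) ≤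
      ‖(if |x| ≤ 1 then Complex.I * ((1 : ℝ) : ℂ) * x else 0 : ℂ)‖ₑ +
        (Iic 0).indicator 1 x + (Ioi 1).indicator 1 x := by
    intro x
    rcases le_or_gt x 0 with h0 | h0
    · rw [indicator_of_mem (s := Iic (0 : ℝ)) (by simpa using h0)]
      refine le_trans ?_ (le_self_add.trans' le_add_self)
      simp
    rcases le_or_gt x 1 with h | h
    · refine le_trans ?_ (le_self_add.trans' le_self_add)
      rw [if_pos (by rwa [abs_of_pos h0]), ← ofReal_norm]
      refine ENNReal.ofReal_le_ofReal ?_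
      simp only [Complex.ofReal_one, mul_one, norm_mul, Complex.norm_I, Complex.norm_real,
        one_mul, Real.norm_eq_abs, abs_of_pos h0]
      exact (min_le_right _ _).trans (by nlinarith)
    · rw [indicator_of_mem (s := Ioi (1 : ℝ)) (by simpa using h)]
      refine le_trans ?_ le_add_self
      simp
  refine (lintegral_mono hle).trans_lt ?_
  rw [lintegral_add_right _ (measurable_one.indicator measurableSet_Ioi),
    lintegral_add_right _ (measurable_one.indicator measurableSet_Iic),
    lintegral_indicator_one measurableSet_Ioi, lintegral_indicator_one measurableSet_Iic,
    oneSidedLevyMeasure_Iic, oneSidedLevyMeasure_Ioi hα.1 hs one_pos, add_zero]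
  exact ENNReal.add_lt_top.2 ⟨h1, ENNReal.ofReal_lt_top⟩

/-- Compensating the small jumps turns the driftless exponent into the Lévy–Khintchine form with
first entry `s / (1 - α)`. -/
lemma hasLevyTriplet_of_charFun {α s : ℝ} (hα : α ∈ Ioo (0 : ℝ) 1) (hs : 0 ≤ s) {F : Measure ℝ}
    (hF : ∀ u, charFun F u = Complex.exp (stableExponent α s u)) :
    HasLevyTriplet F (s / (1 - α)) 0 (oneSidedLevyMeasure α s) where
  levy_zero := measure_mono_null (by simp) (oneSidedLevyMeasure_Iic α s)
  levy_lt_top := lintegral_min_one_sq_oneSidedLevyMeasure hα hs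
  charFun_eq u := by
    have h1 := ((hasPowerTail_oneSidedLevyMeasure hα.1 hs).integrable_exp_sub_one hα.2 u).1
    obtain ⟨h2, h3⟩ := integral_small_jumps hα.2 hs u
    have h4 := integral_sub h1 h2
    rw [hF, stableExponent]
    congr 1
    have h5 : ∀ x : ℝ, Complex.I * ((u * x : ℝ) : ℂ) = Complex.I * u * x := fun x => by
      push_cast; ring
    simp only [h5] at h4 ⊢
    rw [h4, h3]
    simp

lemma isProbabilityMeasure_iidSumLaw (n : ℕ) (μ : Measure ℝ) [IsProbabilityMeasure μ] :
    IsProbabilityMeasure (iidSumLaw n μ) :=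
  Measure.isProbabilityMeasure_map (by fun_prop)

lemma charFun_iidSumLaw (n : ℕ) (μ : Measure ℝ) [IsProbabilityMeasure μ] (u : ℝ) :
    charFun (iidSumLaw n μ) u = charFun μ u ^ n := by
  have h := iIndepFun_pi (μ := fun _ : Fin n => μ) (X := fun _ => (id : ℝ → ℝ))
    (fun _ => aemeasurable_id)
  rw [iidSumLaw]
  have h2 := h.charFun_map_fun_sum_eq_prod fun i => (measurable_pi_apply i).aemeasurable
  rw [h2]
  have : ∀ i : Fin n, (Measure.pi fun _ : Fin n => μ).map (fun ω => ω i) = μ := fun i =>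
    (measurePreserving_eval (fun _ : Fin n => μ) i).map_eq
  simp [this]

lemma isStableLaw_of_charFun {α s : ℝ} (hα : α ∈ Ioo (0 : ℝ) 1) (hs : 0 < s) {F : Measure ℝ}
    [IsProbabilityMeasure F] (hF : ∀ u, charFun F u = Complex.exp (stableExponent α s u)) :
    IsStableLaw α F := by
  refine ⟨fun a ha => ?_, fun n hn => ⟨0, ?_⟩⟩
  · have h1 := hF 1
    rw [ha, charFun_dirac] at h1
    have h2 := congrArg norm h1
    rw [Complex.norm_exp_ofReal_mul_I, Complex.norm_exp] at h2
    have := Real.exp_lt_one_iff.2 (re_stableExponent_one_neg hα hs)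
    linarith
  · have hn0 : (0 : ℝ) < n := by exact_mod_cast hn
    have := isProbabilityMeasure_iidSumLaw n F
    have : IsProbabilityMeasure (F.map fun x => (n : ℝ) ^ (1 / α) * x + 0) :=
      Measure.isProbabilityMeasure_map (by fun_prop)
    refine Measure.ext_of_charFun (funext fun u => ?_)
    simp only [add_zero]
    rw [charFun_iidSumLaw, charFun_map_mul, hF, hF,
      stableExponent_mul hs.le (Real.rpow_pos_of_pos hn0 _), ← Real.rpow_mul hn0.le,
      one_div_mul_cancel hα.1.ne', Real.rpow_one, ← Complex.exp_nat_mul]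
    simp

/-- The `n`-th convolution root is the law of `n^{-1/α} ξ`. -/
lemma isInfDivisible_of_charFun {α s : ℝ} (hα : α ∈ Ioo (0 : ℝ) 1) (hs : 0 < s) {F : Measure ℝ}
    [IsProbabilityMeasure F] (hF : ∀ u, charFun F u = Complex.exp (stableExponent α s u)) :
    IsInfDivisible F := by
  intro n hn
  have hn0 : (0 : ℝ) < n := by exact_mod_cast hn
  have hp : IsProbabilityMeasure (F.map fun x => (n : ℝ) ^ (-(1 / α)) * x) :=
    Measure.isProbabilityMeasure_map (by fun_prop)
  refine ⟨_, hp, ?_⟩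
  have := isProbabilityMeasure_iidSumLaw n (F.map fun x => (n : ℝ) ^ (-(1 / α)) * x)
  refine Measure.ext_of_charFun (funext fun u => ?_)
  rw [charFun_iidSumLaw, charFun_map_mul, hF, hF,
    stableExponent_mul hs.le (Real.rpow_pos_of_pos hn0 _), ← Real.rpow_mul hn0.le,
    neg_mul, one_div_mul_cancel hα.1.ne', Real.rpow_neg_one, ← Complex.exp_nat_mul]
  congr 1
  have : (n : ℂ) ≠ 0 := by exact_mod_cast hn0.ne'
  push_cast
  field_simp

/-- A pointwise limit of characteristic functions of laws on `[0, ∞)` which is continuous at `0` is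
the characteristic function of a law on `[0, ∞)`: the laws are tight, and `(-∞, 0)` is open. -/
lemma exists_probabilityMeasure_charFun_eq {p : ℕ → ProbabilityMeasure ℝ} {φ : ℝ → ℂ}
    (hφ : ContinuousAt φ 0)
    (h : ∀ u, Tendsto (fun n => charFun (p n : Measure ℝ) u) atTop (𝓝 (φ u)))
    (hp : ∀ n, (p n : Measure ℝ) (Iio 0) = 0) :
    ∃ F : ProbabilityMeasure ℝ, (∀ u, charFun (F : Measure ℝ) u = φ u) ∧
      (F : Measure ℝ) (Iio 0) = 0 := by
  have htight := isTightMeasureSet_of_tendsto_charFun (μ := fun n => (p n : Measure ℝ)) hφ h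
  have hcomp : IsCompact (closure (range p)) := by
    refine isCompact_closure_of_isTightMeasureSet ?_
    convert htight using 1
    ext ν
    simp
  obtain ⟨F, -, k, hk, hlim⟩ := hcomp.tendsto_subseq fun n => subset_closure (mem_range_self n)
  refine ⟨F, fun u => ?_, ?_⟩
  · exact tendsto_nhds_unique ((ProbabilityMeasure.tendsto_iff_tendsto_charFun.1 hlim) u)
      ((h u).comp hk.tendsto_atTop)
  · have := ProbabilityMeasure.le_liminf_measure_open_of_tendsto hlim (isOpen_Iio (a := (0 : ℝ)))
    simpa [hp] using this

/-! ### Tails and moments of the component laws -/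

lemma one_sub_cdf_eq (μ : Measure ℝ) [IsProbabilityMeasure μ] (x : ℝ) :
    1 - cdf μ x = μ.real (Ioi x) := by
  rw [cdf_eq_real, ← compl_Iic, probReal_compl_eq_one_sub measurableSet_Iic]

/-- Layer cake formula for the second moment of a law on `[0, ∞)`. -/
lemma lintegral_sq_eq {μ : Measure ℝ} (h0 : ∀ᵐ x ∂μ, 0 ≤ x) :
    ∫⁻ x, ENNReal.ofReal (x ^ 2) ∂μ = ∫⁻ t in Ioi 0, μ (Ioi t) * ENNReal.ofReal (2 * t) := by
  have := lintegral_comp_eq_lintegral_meas_lt_mul (f := fun x : ℝ => x) (g := fun t => 2 * t) μ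
    h0 aemeasurable_id (fun t _ => Continuous.intervalIntegrable (by fun_prop) _ _)
    (by filter_upwards [ae_restrict_mem measurableSet_Ioi] with t ht
        have : (0 : ℝ) < t := ht
        positivity)
  refine Eq.trans ?_ this
  congr 1
  ext x
  congr 1
  rw [intervalIntegral.integral_const_mul, integral_id]
  ring

section LightTail

variable {lam : ℝ} {μ₁ : Measure ℝ}

lemma IsLightTail.ae_nonneg (h : IsLightTail lam μ₁) : ∀ᵐ x ∂μ₁, 0 ≤ x := by
  rw [ae_iff]; simpa [Iio_def] using h.nonneg

lemma IsLightTail.exists_tail_le (h : IsLightTail lam μ₁) (hlam : 0 < lam) :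
    ∃ C, 0 < C ∧ ∀ x, μ₁.real (Ioi x) ≤ C * Real.exp (-(lam * x)) := by
  have := h.prob
  obtain ⟨A, hA⟩ := h.tail.isBigO.bound
  obtain ⟨x₀, hx₀⟩ := eventually_atTop.1 hA
  refine ⟨|A| + Real.exp (lam * x₀), by positivity, fun x => ?_⟩
  rcases le_total x₀ x with hle | hle
  · have h1 := hx₀ x hle
    rw [one_sub_cdf_eq, Real.norm_eq_abs, Real.norm_eq_abs, abs_of_nonneg measureReal_nonneg,
      Real.abs_exp] at h1
    refine h1.trans ?_
    gcongr
    linarith [le_abs_self A, Real.exp_pos (lam * x₀)]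
  · have h1 : 1 ≤ Real.exp (lam * x₀) * Real.exp (-(lam * x)) := by
      rw [← Real.exp_add, Real.one_le_exp_iff]
      nlinarith
    have h2 : μ₁.real (Ioi x) ≤ 1 := measureReal_le_one
    have h3 : 0 ≤ |A| * Real.exp (-(lam * x)) := by positivity
    linarith

lemma IsLightTail.memLp_two (h : IsLightTail lam μ₁) (hlam : 0 < lam) : MemLp id 2 μ₁ := by
  have := h.prob
  rw [memLp_two_iff_integrable_sq aestronglyMeasurable_id]
  refine ⟨by fun_prop, ?_⟩
  rw [hasFiniteIntegral_iff_ofReal (ae_of_all _ fun x => by positivity)]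
  simp only [id]
  rw [lintegral_sq_eq h.ae_nonneg]
  obtain ⟨C, hC, hle⟩ := h.exists_tail_le hlam
  have hint : IntegrableOn (fun t : ℝ => C * 2 * (t ^ (1 : ℝ) * Real.exp (-lam * t ^ (1 : ℝ))))
      (Ioi 0) :=
    (integrableOn_rpow_mul_exp_neg_mul_rpow (by norm_num) one_pos hlam).const_mul _
  refine lt_of_le_of_lt (setLIntegral_mono' measurableSet_Ioi fun t ht => ?_)
    hint.lintegral_lt_top
  have ht : 0 < t := ht
  rw [← ofReal_measureReal, ← ENNReal.ofReal_mul measureReal_nonneg]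
  refine ENNReal.ofReal_le_ofReal ?_
  rw [Real.rpow_one]
  have := hle t
  calc μ₁.real (Ioi t) * (2 * t) ≤ C * Real.exp (-(lam * t)) * (2 * t) := by gcongr
    _ = _ := by ring_nf

/-- The light-tailed law has unbounded support, hence is not degenerate: otherwise its tail would
vanish from the mean on, and could not be equivalent to `e^{-λ x}`. -/
lemma IsLightTail.variance_pos (h : IsLightTail lam μ₁) (hlam : 0 < lam) :
    0 < ∫ x, (x - ∫ y, y ∂μ₁) ^ 2 ∂μ₁ := by
  have := h.prob
  set m := ∫ y, y ∂μ₁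
  have hint := integrable_sub_sq (h.memLp_two hlam) m
  refine lt_of_le_of_ne (integral_nonneg fun x => sq_nonneg _) fun h0 => ?_
  have hae := (integral_eq_zero_iff_of_nonneg (fun x => sq_nonneg _) hint).1 h0.symm
  have hle : ∀ᵐ x ∂μ₁, x ≤ m := by
    filter_upwards [hae] with x hx
    have : x - m = 0 := by simpa using hx
    linarith
  have hzero : ∀ x ≥ m, 1 - cdf μ₁ x = 0 := by
    intro x hx
    rw [one_sub_cdf_eq, measureReal_def, measure_mono_null (t := Ioi m) (Ioi_subset_Ioi hx)]
    · simp
    · rw [ae_iff] at hle; simpa [Ioi_def] using hle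
  have h1 := (isEquivalent_iff_tendsto_one (Eventually.of_forall fun x => (Real.exp_pos _).ne')).1
    h.tail
  have h2 : Tendsto ((fun x : ℝ => 1 - cdf μ₁ x) / fun x : ℝ => Real.exp (-(lam * x))) atTop
      (𝓝 0) := by
    refine tendsto_const_nhds.congr' ?_
    filter_upwards [eventually_ge_atTop m] with x hx
    simp [hzero x hx]
  exact one_ne_zero (tendsto_nhds_unique h1 h2)

end LightTail

section HeavyTail

variable {α : ℝ} {μ₂ : Measure ℝ}

lemma IsHeavyTail.ae_one_le (h : IsHeavyTail α μ₂) : ∀ᵐ x ∂μ₂, 1 ≤ x := by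
  rw [ae_iff]; simpa [Iio_def] using h.one_le

lemma IsHeavyTail.tendsto_tail (h : IsHeavyTail α μ₂) :
    Tendsto (fun x => x ^ α * μ₂.real (Ioi x)) atTop (𝓝 1) := by
  have := h.prob
  have h1 := (isEquivalent_iff_tendsto_one (by
    filter_upwards [eventually_gt_atTop 0] with x hx using (Real.rpow_pos_of_pos hx _).ne')).1
    h.tail
  refine h1.congr' ?_
  filter_upwards [eventually_gt_atTop 0] with x hx
  simp only [Pi.div_apply, one_sub_cdf_eq]
  rw [Real.rpow_neg hx.le, div_inv_eq_mul, mul_comm]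

lemma IsHeavyTail.exists_tail_le (h : IsHeavyTail α μ₂) (hα : 0 < α) :
    ∃ C, 0 < C ∧ ∀ x, 0 < x → μ₂.real (Ioi x) ≤ C * x ^ (-α) := by
  have := h.prob
  obtain ⟨x₀, hx₀⟩ := eventually_atTop.1 (h.tendsto_tail.eventually (gt_mem_nhds one_lt_two))
  refine ⟨2 + (max x₀ 1) ^ α, by positivity, fun x hx => ?_⟩
  have hxa := Real.rpow_pos_of_pos hx α
  rw [Real.rpow_neg hx.le, ← div_eq_mul_inv, le_div_iff₀ hxa, mul_comm]
  have hm : 0 ≤ (max x₀ 1) ^ α := by positivity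
  rcases le_total x₀ x with hle | hle
  · linarith [hx₀ x hle]
  · have h1 : x ^ α ≤ (max x₀ 1) ^ α := by
      gcongr; exact hle.trans (le_max_left _ _)
    have h2 : μ₂.real (Ioi x) ≤ 1 := measureReal_le_one
    have : x ^ α * μ₂.real (Ioi x) ≤ x ^ α * 1 := by gcongr
    linarith

lemma IsHeavyTail.tendsto_real_Iic (h : IsHeavyTail α μ₂) :
    Tendsto (fun M => μ₂.real (Iic M)) atTop (𝓝 1) := by
  have := h.prob
  exact (tendsto_cdf_atTop μ₂).congr fun x => cdf_eq_real μ₂ x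

lemma truncatedLaw_apply (μ₂ : Measure ℝ) (M : ℝ) (s : Set ℝ) :
    truncatedLaw μ₂ M s = (μ₂ (Iic M))⁻¹ * μ₂ (Iic M ∩ s) := by
  rw [truncatedLaw, cond_apply measurableSet_Iic]

lemma isProbabilityMeasure_truncatedLaw [IsProbabilityMeasure μ₂] {M : ℝ}
    (hM : 0 < μ₂.real (Iic M)) : IsProbabilityMeasure (truncatedLaw μ₂ M) :=
  cond_isProbabilityMeasure fun h0 => by simp [measureReal_def, h0] at hM

lemma truncatedLaw_real_Ioi [IsProbabilityMeasure μ₂] {M x : ℝ} (hx : x ≤ M) :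
    (truncatedLaw μ₂ M).real (Ioi x) =
      (μ₂.real (Iic M))⁻¹ * (μ₂.real (Ioi x) - μ₂.real (Ioi M)) := by
  rw [measureReal_def, truncatedLaw_apply, ENNReal.toReal_mul, ENNReal.toReal_inv,
    ← measureReal_def, ← measureReal_def, Iic_inter_Ioi, ← Ioi_sdiff_Ioi,
    measureReal_sdiff (Ioi_subset_Ioi hx) measurableSet_Ioi]

lemma truncatedLaw_Ioi_le [IsProbabilityMeasure μ₂] {M : ℝ} (hM : 1 / 2 ≤ μ₂.real (Iic M))
    (x : ℝ) : truncatedLaw μ₂ M (Ioi x) ≤ ENNReal.ofReal (2 * μ₂.real (Ioi x)) := by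
  rw [truncatedLaw_apply, ENNReal.ofReal_mul zero_le_two, ofReal_measureReal]
  gcongr
  · rw [← ofReal_measureReal, ← ENNReal.ofReal_inv_of_pos (by linarith)]
    refine ENNReal.ofReal_le_ofReal ?_
    rw [inv_le_comm₀ (by linarith) two_pos]
    linarith
  · exact inter_subset_right

lemma truncatedLaw_absolutelyContinuous (μ₂ : Measure ℝ) (M : ℝ) : truncatedLaw μ₂ M ≪ μ₂ :=
  cond_absolutelyContinuous

lemma truncatedLaw_ae_le (μ₂ : Measure ℝ) (M : ℝ) : ∀ᵐ y ∂(truncatedLaw μ₂ M), y ≤ M := by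
  rw [ae_iff, truncatedLaw_apply]
  have : Iic M ∩ {a | ¬a ≤ M} = ∅ := by ext; simp
  rw [this, measure_empty, mul_zero]

lemma IsHeavyTail.ae_mem_Icc (h : IsHeavyTail α μ₂) (M : ℝ) :
    ∀ᵐ y ∂(truncatedLaw μ₂ M), y ∈ Icc 1 M := by
  filter_upwards [(truncatedLaw_absolutelyContinuous μ₂ M).ae_le h.ae_one_le,
    truncatedLaw_ae_le μ₂ M] with y h1 h2 using ⟨h1, h2⟩

lemma IsHeavyTail.memLp_truncatedLaw (h : IsHeavyTail α μ₂) (M : ℝ) :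
    MemLp id 2 (truncatedLaw μ₂ M) := by
  have := h.prob
  have : IsFiniteMeasure (truncatedLaw μ₂ M) := by unfold truncatedLaw; infer_instance
  refine MemLp.of_bound aestronglyMeasurable_id (|M|) ?_
  filter_upwards [h.ae_mem_Icc M] with y hy
  rw [id, Real.norm_eq_abs, abs_of_nonneg (by linarith [hy.1])]
  exact hy.2.trans (le_abs_self M)

/-- The second moment of the truncated law is at most of order `M^{2-α}`, by integration of the tail
bound over `(0, M]`. -/
lemma IsHeavyTail.exists_integral_sq_le (h : IsHeavyTail α μ₂) (hα : α ∈ Ioo (0 : ℝ) 1) :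
    ∃ C, 0 < C ∧ ∀ᶠ M in atTop, ∫ y, y ^ 2 ∂(truncatedLaw μ₂ M) ≤ C * M ^ (2 - α) := by
  have := h.prob
  obtain ⟨C, hC, hle⟩ := h.exists_tail_le hα.1
  have h2α : 0 < 2 - α := by linarith [hα.2]
  refine ⟨4 * C / (2 - α), by positivity, ?_⟩
  filter_upwards [h.tendsto_real_Iic.eventually (lt_mem_nhds (show (1 / 2 : ℝ) < 1 by norm_num)),
    eventually_gt_atTop 0] with M hM hM0
  have h0 : ∀ᵐ y ∂(truncatedLaw μ₂ M), 0 ≤ y := by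
    filter_upwards [h.ae_mem_Icc M] with y hy using zero_le_one.trans hy.1
  have hint : IntegrableOn (fun t : ℝ => 4 * C * t ^ (1 - α)) (Ioc 0 M) := by
    rw [← intervalIntegrable_iff_integrableOn_Ioc_of_le hM0.le]
    exact (intervalIntegral.intervalIntegrable_rpow' (by linarith [hα.2])).const_mul _
  rw [integral_eq_lintegral_of_nonneg_ae (ae_of_all _ fun y => sq_nonneg y) (by fun_prop),
    lintegral_sq_eq h0]
  refine ENNReal.toReal_le_of_le_ofReal (by positivity) ?_
  calc ∫⁻ t in Ioi 0, truncatedLaw μ₂ M (Ioi t) * ENNReal.ofReal (2 * t)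
      ≤ ∫⁻ t in Ioi 0, (Iic M).indicator (fun t => ENNReal.ofReal (4 * C * t ^ (1 - α))) t := by
        refine setLIntegral_mono' measurableSet_Ioi fun t ht => ?_
        have ht : 0 < t := ht
        by_cases htM : t ≤ M
        · rw [indicator_of_mem (by simpa using htM)]
          refine (mul_le_mul_left (truncatedLaw_Ioi_le hM.le t) _).trans ?_
          rw [← ENNReal.ofReal_mul (by positivity)]
          refine ENNReal.ofReal_le_ofReal ?_
          have h1 : t ^ (1 - α) = t ^ (-α) * t := by
            rw [← Real.rpow_add_one ht.ne']; ring_nf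
          rw [h1]
          nlinarith [mul_le_mul_of_nonneg_right (hle t ht) ht.le]
        · have : truncatedLaw μ₂ M (Ioi t) = 0 := by
            have := truncatedLaw_ae_le μ₂ M
            rw [ae_iff] at this
            refine measure_mono_null (fun y hy => ?_) this
            have : t < y := hy
            simp only [mem_ofPred_eq, not_le] at htM ⊢
            exact htM.trans this
          rw [this, zero_mul]
          exact zero_le
    _ = ENNReal.ofReal (4 * C / (2 - α) * M ^ (2 - α)) := by
        rw [lintegral_indicator measurableSet_Iic, Measure.restrict_restrict measurableSet_Iic,
          Iic_inter_Ioi, ← ofReal_integral_eq_lintegral_ofReal hint]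
        · rw [integral_const_mul, ← intervalIntegral.integral_of_le hM0.le,
            integral_rpow (Or.inl (by linarith [hα.2])), show 1 - α + 1 = 2 - α by ring,
            Real.zero_rpow h2α.ne']
          congr 1
          ring
        · filter_upwards [ae_restrict_mem measurableSet_Ioc] with t ht
          have : 0 < t := ht.1
          positivity

/-- The second moment of the truncated law is at least of order `M^{2-α}`: the interval
`(δ M, M]` carries mass of order `M^{-α}` if `δ` is small. -/
lemma IsHeavyTail.exists_le_integral_sq (h : IsHeavyTail α μ₂) (hα : α ∈ Ioo (0 : ℝ) 1) :
    ∃ c, 0 < c ∧ ∀ᶠ M in atTop, c * M ^ (2 - α) ≤ ∫ y, y ^ 2 ∂(truncatedLaw μ₂ M) := by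
  have := h.prob
  -- then `(δ M)^{-α} = 8 M^{-α}`, so for large `M` the law `μ₂` gives mass at least `4 M^{-α}` to
  -- `(δ M, ∞)` and at most `2 M^{-α}` to `(M, ∞)`
  set δ : ℝ := 8 ^ (-(1 / α)) with hδ
  have hδ0 : 0 < δ := by positivity
  have hδ1 : δ ≤ 1 := Real.rpow_le_one_of_one_le_of_nonpos (by norm_num)
    (by have := hα.1; simp only [Left.neg_nonpos_iff]; positivity)
  have hδα : δ ^ α = 1 / 8 := by
    rw [hδ, ← Real.rpow_mul (by norm_num), neg_mul, one_div_mul_cancel hα.1.ne',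
      Real.rpow_neg_one]
    norm_num
  refine ⟨δ ^ 2 * 2, by positivity, ?_⟩
  have hδM : Tendsto (fun M : ℝ => δ * M) atTop atTop := tendsto_id.const_mul_atTop hδ0
  filter_upwards [(h.tendsto_tail.comp hδM).eventually
      (lt_mem_nhds (show (1 / 2 : ℝ) < 1 by norm_num)),
    h.tendsto_tail.eventually (gt_mem_nhds one_lt_two),
    h.tendsto_real_Iic.eventually (lt_mem_nhds zero_lt_one),
    eventually_gt_atTop 0] with M h1 h2 h3 hM0
  have hprob := isProbabilityMeasure_truncatedLaw h3
  simp only [Function.comp_apply] at h1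
  rw [Real.mul_rpow hδ0.le hM0.le, hδα] at h1
  have hMα := Real.rpow_pos_of_pos hM0 α
  have hMneg : M ^ (-α) * M ^ α = 1 := by
    rw [← Real.rpow_add hM0]; simp
  have hMn := Real.rpow_pos_of_pos hM0 (-α)
  have h4 : 4 * M ^ (-α) ≤ μ₂.real (Ioi (δ * M)) := by
    have : M ^ (-α) * (1 / 2) ≤ M ^ (-α) * (1 / 8 * M ^ α * μ₂.real (Ioi (δ * M))) := by gcongr
    linear_combination 8 * this + μ₂.real (Ioi (δ * M)) * hMneg
  have h5 : μ₂.real (Ioi M) ≤ 2 * M ^ (-α) := by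
    have : M ^ (-α) * (M ^ α * μ₂.real (Ioi M)) ≤ M ^ (-α) * 2 := by gcongr
    linear_combination this - μ₂.real (Ioi M) * hMneg
  have h6 : 2 * M ^ (-α) ≤ (truncatedLaw μ₂ M).real (Ioi (δ * M)) := by
    rw [truncatedLaw_real_Ioi (by nlinarith)]
    have h7 : 1 ≤ (μ₂.real (Iic M))⁻¹ := (one_le_inv₀ h3).2 measureReal_le_one
    have h8 : 2 * M ^ (-α) ≤ μ₂.real (Ioi (δ * M)) - μ₂.real (Ioi M) := by linarith
    exact h8.trans (le_mul_of_one_le_left (by linarith) h7)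
  have hint := (h.memLp_truncatedLaw M).integrable_sq
  have hpow : M ^ (2 - α) = M ^ 2 * M ^ (-α) := by
    rw [sub_eq_add_neg, Real.rpow_add hM0, Real.rpow_two]
  calc δ ^ 2 * 2 * M ^ (2 - α) = (δ * M) ^ 2 * (2 * M ^ (-α)) := by rw [hpow]; ring
    _ ≤ (δ * M) ^ 2 * (truncatedLaw μ₂ M).real (Ioi (δ * M)) := by gcongr
    _ = ∫ y, (Ioi (δ * M)).indicator (fun _ => (δ * M) ^ 2) y ∂(truncatedLaw μ₂ M) := by
      rw [integral_indicator_const _ measurableSet_Ioi, smul_eq_mul, mul_comm]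
    _ ≤ ∫ y, y ^ 2 ∂(truncatedLaw μ₂ M) := by
      refine integral_mono ((integrable_const _).indicator measurableSet_Ioi) hint fun y => ?_
      by_cases hy : δ * M < y
      · rw [indicator_of_mem (by simpa using hy)]
        have : 0 < δ * M := by positivity
        change (δ * M) ^ 2 ≤ y ^ 2
        gcongr
      · rw [indicator_of_notMem (by simpa using hy)]
        exact sq_nonneg y

end HeavyTail

/-! ### Mixture laws and row sums -/

/-- The mixture `(1 - ε) μ + ε ν`. -/
noncomputable def mixtureLaw (ε : ℝ) (μ ν : Measure ℝ) : Measure ℝ :=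
  ENNReal.ofReal (1 - ε) • μ + ENNReal.ofReal ε • ν

section MixtureLaw

variable {ε : ℝ} {μ ν : Measure ℝ}

lemma isProbabilityMeasure_mixtureLaw [IsProbabilityMeasure μ] [IsProbabilityMeasure ν]
    (h0 : 0 ≤ ε) (h1 : ε ≤ 1) : IsProbabilityMeasure (mixtureLaw ε μ ν) := by
  refine ⟨?_⟩
  simp only [mixtureLaw, Measure.add_apply, Measure.smul_apply, measure_univ, smul_eq_mul, mul_one]
  rw [← ENNReal.ofReal_add (by linarith) h0]
  simp

lemma integrable_mixtureLaw {E : Type*} [NormedAddCommGroup E] {f : ℝ → E}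
    (hμ : Integrable f μ) (hν : Integrable f ν) : Integrable f (mixtureLaw ε μ ν) :=
  (hμ.smul_measure ENNReal.ofReal_ne_top).add_measure (hν.smul_measure ENNReal.ofReal_ne_top)

lemma integral_mixtureLaw {E : Type*} [NormedAddCommGroup E] [NormedSpace ℝ E]
    (h0 : 0 ≤ ε) (h1 : ε ≤ 1) {f : ℝ → E}
    (hμ : Integrable f μ) (hν : Integrable f ν) :
    ∫ x, f x ∂(mixtureLaw ε μ ν) = (1 - ε) • ∫ x, f x ∂μ + ε • ∫ x, f x ∂ν := by
  rw [mixtureLaw, integral_add_measure (hμ.smul_measure ENNReal.ofReal_ne_top)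
    (hν.smul_measure ENNReal.ofReal_ne_top), integral_smul_measure, integral_smul_measure,
    ENNReal.toReal_ofReal (by linarith), ENNReal.toReal_ofReal h0]

lemma memLp_two_mixtureLaw (hμ : MemLp id 2 μ) (hν : MemLp id 2 ν) :
    MemLp id 2 (mixtureLaw ε μ ν) := by
  rw [memLp_two_iff_integrable_sq aestronglyMeasurable_id]
  exact integrable_mixtureLaw hμ.integrable_sq hν.integrable_sq

/-- Up to a null set, `Z` is `X` on the event `B = 0` and `Y` on the event `B = 1`; each of
these events is independent of the variable selected on it. -/
lemma hasLaw_mix {Ω : Type*} [MeasurableSpace Ω] {P : Measure Ω} [IsProbabilityMeasure P]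
    {X Y B : Ω → ℝ} (hX : HasLaw X μ P) (hY : HasLaw Y ν P) (hB : AEMeasurable B P)
    (hB1 : P.real {ω | B ω = 1} = ε) (hB0 : P.real {ω | B ω = 0} = 1 - ε)
    (hXB : IndepFun X B P) (hYB : IndepFun Y B P) :
    HasLaw (mix X Y B) (mixtureLaw ε μ ν) P := by
  have hXm := hX.aemeasurable
  have hYm := hY.aemeasurable
  have hmix : AEMeasurable (mix X Y B) P := by unfold mix; fun_prop
  have hm0 : NullMeasurableSet (B ⁻¹' {0}) P := hB.nullMeasurable (measurableSet_singleton 0)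
  have hm1 : NullMeasurableSet (B ⁻¹' {1}) P := hB.nullMeasurable (measurableSet_singleton 1)
  have hdisj : Disjoint (B ⁻¹' {0}) (B ⁻¹' {1}) :=
    Disjoint.preimage _ (by simp)
  have e1 : P (B ⁻¹' {1}) = ENNReal.ofReal ε := by rw [← hB1, ofReal_measureReal]; rfl
  have e0 : P (B ⁻¹' {0}) = ENNReal.ofReal (1 - ε) := by rw [← hB0, ofReal_measureReal]; rfl
  have hfull : ∀ᵐ ω ∂P, ω ∈ B ⁻¹' {0} ∪ B ⁻¹' {1} := by
    refine (mem_ae_iff_prob_eq_one₀ (hm0.union hm1)).2 ?_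
    rw [measure_union₀ hm1 hdisj.aedisjoint, e0, e1, ← ENNReal.ofReal_add
      (by rw [← hB0]; exact measureReal_nonneg) (by rw [← hB1]; exact measureReal_nonneg)]
    simp
  refine ⟨hmix, Measure.ext fun s hs => ?_⟩
  rw [Measure.map_apply_of_aemeasurable hmix hs]
  have hset : mix X Y B ⁻¹' s =ᵐ[P]
      (X ⁻¹' s ∩ B ⁻¹' {0} ∪ Y ⁻¹' s ∩ B ⁻¹' {1} : Set Ω) := by
    filter_upwards [hfull] with ω hω
    refine propext ?_
    change mix X Y B ω ∈ s ↔ (X ω ∈ s ∧ B ω = 0) ∨ (Y ω ∈ s ∧ B ω = 1)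
    rcases hω with h | h
    · have h : B ω = 0 := h
      simp [mix, h]
    · have h : B ω = 1 := h
      simp [mix, h]
  rw [measure_congr hset, measure_union₀ ((hYm.nullMeasurable hs).inter hm1)
    (hdisj.mono inter_subset_right inter_subset_right).aedisjoint,
    hXB.measure_inter_preimage_eq_mul _ _ hs (measurableSet_singleton 0),
    hYB.measure_inter_preimage_eq_mul _ _ hs (measurableSet_singleton 1), e0, e1, mixtureLaw,
    Measure.add_apply, Measure.smul_apply, Measure.smul_apply,
    ← Measure.map_apply_of_aemeasurable hXm hs, ← Measure.map_apply_of_aemeasurable hYm hs,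
    hX.map_eq, hY.map_eq, smul_eq_mul, smul_eq_mul, mul_comm, mul_comm (ν s)]

end MixtureLaw

/-- The characteristic function, at `u`, of `(Z - b) / a` when `Z` has law `ζ`. -/
noncomputable def affineCharFun (ζ : Measure ℝ) (b a u : ℝ) : ℂ :=
  ∫ z, Complex.exp (Complex.I * ((u * ((z - b) / a) : ℝ) : ℂ)) ∂ζ

lemma affineCharFun_eq (ζ : Measure ℝ) (b a u : ℝ) : affineCharFun ζ b a u =
    Complex.exp (-(Complex.I * ((u * (b / a) : ℝ) : ℂ))) * charFun ζ (u / a) := by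
  rw [affineCharFun, charFun_apply_real, ← integral_const_mul]
  congr 1
  ext z
  rw [← Complex.exp_add]
  congr 1
  push_cast
  ring

section Array

variable {μ₁ μ₂ : Measure ℝ} {γ₁ γ₂ : ℝ} {Ω : ℕ → Type*} [∀ n, MeasurableSpace (Ω n)]
  {P : (n : ℕ) → Measure (Ω n)} {X Y B : (n : ℕ) → ℕ → Ω n → ℝ}

/-- The common law of the variables `Z_{nk}` in row `n` of the array. -/
noncomputable def rowLaw (μ₁ μ₂ : Measure ℝ) (γ₁ γ₂ : ℝ) (n : ℕ) : Measure ℝ :=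
  mixtureLaw ((n : ℝ) ^ (-γ₂)) μ₁ (truncatedLaw μ₂ ((n : ℝ) ^ γ₁))

lemma IsMixtureArray.hasLaw_mix [∀ n, IsProbabilityMeasure (P n)]
    (hA : IsMixtureArray μ₁ μ₂ γ₁ γ₂ P X Y B) {n k : ℕ} (hk : k < n)
    (hn : 0 < μ₂ (Iic ((n : ℝ) ^ γ₁))) :
    HasLaw (mix (X n k) (Y n k) (B n k)) (rowLaw μ₁ μ₂ γ₁ γ₂ n) (P n) := by
  refine MixtureLimit.hasLaw_mix (hA.law_X n k hk) (hA.law_Y n hn k hk) (hA.aemeasurable_B n k hk)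
    (hA.law_B_one n k hk) (hA.law_B_zero n k hk) ?_ ?_
  · exact (hA.indep n).indepFun (i := Sum.inl ⟨k, hk⟩) (j := Sum.inr (Sum.inr ⟨k, hk⟩)) (by simp)
  · exact (hA.indep n).indepFun (i := Sum.inr (Sum.inl ⟨k, hk⟩)) (j := Sum.inr (Sum.inr ⟨k, hk⟩))
      (by simp)

lemma IsMixtureArray.aemeasurable_mix (hA : IsMixtureArray μ₁ μ₂ γ₁ γ₂ P X Y B) {n k : ℕ}
    (hk : k < n) : AEMeasurable (mix (X n k) (Y n k) (B n k)) (P n) := by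
  have h1 := (hA.law_X n k hk).aemeasurable
  have h2 := hA.aemeasurable_Y n k hk
  have h3 := hA.aemeasurable_B n k hk
  unfold mix
  fun_prop

lemma IsMixtureArray.aemeasurable_partialSum (hA : IsMixtureArray μ₁ μ₂ γ₁ γ₂ P X Y B) {n k : ℕ}
    (hk : k ≤ n) :
    AEMeasurable (fun ω => ∑ j ∈ Finset.range k, mix (X n j) (Y n j) (B n j) ω) (P n) :=
  Finset.aemeasurable_fun_sum _ fun _ hj =>
    hA.aemeasurable_mix ((Finset.mem_range.1 hj).trans_le hk)

lemma IsMixtureArray.aemeasurable_rowSum (hA : IsMixtureArray μ₁ μ₂ γ₁ γ₂ P X Y B) (n : ℕ) :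
    AEMeasurable (rowSum X Y B n) (P n) := hA.aemeasurable_partialSum le_rfl

/-- Each `Z_{nk}` is independent of the sum of the preceding ones, as these are functions of
disjoint groups of independent variables. -/
lemma IsMixtureArray.indepFun_partialSum (hA : IsMixtureArray μ₁ μ₂ γ₁ γ₂ P X Y B) {n k : ℕ}
    (hk : k < n) :
    IndepFun (fun ω => ∑ j ∈ Finset.range k, mix (X n j) (Y n j) (B n j) ω)
      (mix (X n k) (Y n k) (B n k)) (P n) := by
  classical
  set f : Fin n ⊕ (Fin n ⊕ Fin n) → Ω n → ℝ := fun i =>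
      Sum.elim (fun k : Fin n => X n k)
        (Sum.elim (fun k : Fin n => Y n k) (fun k : Fin n => B n k)) i with hf
  have hmeas : ∀ i, AEMeasurable (f i) (P n) := by
    rintro (i | i | i)
    · exact (hA.law_X n i i.2).aemeasurable
    · exact hA.aemeasurable_Y n i i.2
    · exact hA.aemeasurable_B n i i.2
  let idx : Fin n ⊕ (Fin n ⊕ Fin n) → ℕ := fun i =>
    Sum.elim (fun k : Fin n => (k : ℕ)) (Sum.elim (fun k : Fin n => (k : ℕ))
      (fun k : Fin n => (k : ℕ))) i
  let S : Finset (Fin n ⊕ (Fin n ⊕ Fin n)) := Finset.univ.filter fun i => idx i < k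
  let T : Finset (Fin n ⊕ (Fin n ⊕ Fin n)) := Finset.univ.filter fun i => idx i = k
  have hST : Disjoint S T := Finset.disjoint_filter.2 fun i _ h1 h2 => by omega
  have hind := (hA.indep n).indepFun_finset₀ S T hST hmeas
  -- extend a tuple indexed by a finset by zero, to evaluate it at arbitrary indices
  let ext : (U : Finset (Fin n ⊕ (Fin n ⊕ Fin n))) → (U → ℝ) → Fin n ⊕ (Fin n ⊕ Fin n) → ℝ :=
    fun U x i => if h : i ∈ U then x ⟨i, h⟩ else 0
  have hext : ∀ U i, Measurable fun x => ext U x i := by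
    intro U i
    by_cases h : i ∈ U
    · simp only [ext, h, dite_true]; fun_prop
    · simp only [ext, h, dite_false]; fun_prop
  let z : (U : Finset (Fin n ⊕ (Fin n ⊕ Fin n))) → (U → ℝ) → Fin n → ℝ := fun U x j =>
    (1 - ext U x (Sum.inr (Sum.inr j))) * ext U x (Sum.inl j) +
      ext U x (Sum.inr (Sum.inr j)) * ext U x (Sum.inr (Sum.inl j))
  have hz : ∀ U j, Measurable fun x => z U x j := by
    intro U j
    have h1 := hext U (Sum.inl j)
    have h2 := hext U (Sum.inr (Sum.inl j))
    have h3 := hext U (Sum.inr (Sum.inr j))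
    fun_prop
  have hcomp := hind.comp
    (φ := fun x => ∑ j : Fin k, z S x (Fin.castLE hk.le j)) (ψ := fun x => z T x ⟨k, hk⟩)
    (Finset.measurable_fun_sum _ fun j _ => hz S _) (hz T _)
  convert hcomp using 1
  · ext ω
    simp only [Function.comp_apply]
    rw [Finset.sum_range]
    refine Finset.sum_congr rfl fun j _ => ?_
    simp [z, ext, S, idx, mix]
  · ext ω
    simp [Function.comp_apply, z, ext, T, idx, mix]

lemma IsMixtureArray.charFun_partialSum [∀ n, IsProbabilityMeasure (P n)]
    (hA : IsMixtureArray μ₁ μ₂ γ₁ γ₂ P X Y B) {n k : ℕ}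
    (hk : k ≤ n) (hn : 0 < μ₂ (Iic ((n : ℝ) ^ γ₁))) (u : ℝ) :
    charFun ((P n).map fun ω => ∑ j ∈ Finset.range k, mix (X n j) (Y n j) (B n j) ω) u =
      charFun (rowLaw μ₁ μ₂ γ₁ γ₂ n) u ^ k := by
  induction k with
  | zero => simp
  | succ k ih =>
    have hk' : k < n := hk
    simp only [Finset.sum_range_succ]
    rw [(hA.indepFun_partialSum hk').charFun_map_fun_add_eq_mul
      (hA.aemeasurable_partialSum hk'.le) (hA.aemeasurable_mix hk'), Pi.mul_apply, ih hk'.le,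
      (hA.hasLaw_mix hk' hn).map_eq, pow_succ]

/-- The centring `n b + r a` consists of a part `n b`, which is absorbed into the summands, and a
multiple of the scale, which gives a phase. -/
lemma IsMixtureArray.charFun_rowSum [∀ n, IsProbabilityMeasure (P n)]
    (hA : IsMixtureArray μ₁ μ₂ γ₁ γ₂ P X Y B) {n : ℕ}
    (hn : 0 < μ₂ (Iic ((n : ℝ) ^ γ₁))) {a : ℝ} (ha : a ≠ 0) (b r u : ℝ) :
    charFun ((P n).map fun ω => (rowSum X Y B n ω - (n * b + r * a)) / a) u =
      Complex.exp (-(Complex.I * ((u * r : ℝ) : ℂ))) *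
        affineCharFun (rowLaw μ₁ μ₂ γ₁ γ₂ n) b a u ^ n := by
  have h1 : (fun ω => (rowSum X Y B n ω - (n * b + r * a)) / a) =
      (fun x => x + (-(n * b + r * a) / a)) ∘ fun ω => a⁻¹ * rowSum X Y B n ω := by
    ext ω; simp only [Function.comp_apply]; ring
  rw [h1, ← AEMeasurable.map_map_of_aemeasurable (by fun_prop)
    ((hA.aemeasurable_rowSum n).const_mul _), charFun_map_add_const,
    charFun_map_mul_comp (hA.aemeasurable_rowSum n)]
  have h2 := hA.charFun_partialSum le_rfl hn (a⁻¹ * u)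
  unfold rowSum
  rw [h2, affineCharFun_eq, mul_pow, ← Complex.exp_nat_mul, ← mul_assoc, ← Complex.exp_add,
    mul_comm, show a⁻¹ * u = u / a by ring]
  congr 2
  simp only [RCLike.inner_apply, conj_trivial]
  push_cast
  have : (a : ℂ) ≠ 0 := by exact_mod_cast ha
  field_simp
  ring

variable [∀ n, IsProbabilityMeasure (P n)]

lemma tendstoInDistribution_of_tendsto_charFun {W : (n : ℕ) → Ω n → ℝ}
    (hW : ∀ n, AEMeasurable (W n) (P n)) {F : Measure ℝ} [IsProbabilityMeasure F] {Z : ℝ → ℝ}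
    (hZ : AEMeasurable Z F)
    (h : ∀ u, Tendsto (fun n => charFun ((P n).map (W n)) u) atTop (𝓝 (charFun (F.map Z) u))) :
    TendstoInDistribution W atTop Z P F where
  forall_aemeasurable := hW
  aemeasurable_limit := hZ
  tendsto := ProbabilityMeasure.tendsto_iff_tendsto_charFun.2 h

/-- Reduction of a limit theorem for the row sums to the asymptotics of the characteristic function
`φ_n` of a single normalized summand: if `n (φ_n - 1) → ψ`, then `φ_n ^ n → e^ψ`. -/
lemma IsMixtureArray.tendstoInDistribution (hA : IsMixtureArray μ₁ μ₂ γ₁ γ₂ P X Y B)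
    (hpos : ∀ᶠ n : ℕ in atTop, 0 < μ₂ (Iic ((n : ℝ) ^ γ₁)))
    {κ a b r : ℕ → ℝ} {r₀ : ℝ} (ha : ∀ᶠ n in atTop, 0 < a n)
    (hκ : ∀ᶠ n in atTop, κ n = n * b n + r n * a n) (hr : Tendsto r atTop (𝓝 r₀))
    {ψ : ℝ → ℂ}
    (hψ : ∀ u, Tendsto (fun n : ℕ => n * (affineCharFun (rowLaw μ₁ μ₂ γ₁ γ₂ n) (b n) (a n) u - 1))
      atTop (𝓝 (ψ u)))
    {F : Measure ℝ} [IsProbabilityMeasure F] {Z : ℝ → ℝ} (hZ : AEMeasurable Z F)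
    (hF : ∀ u, charFun (F.map Z) u =
      Complex.exp (-(Complex.I * ((u * r₀ : ℝ) : ℂ))) * Complex.exp (ψ u)) :
    TendstoInDistribution (fun (n : ℕ) (ω : Ω n) => (rowSum X Y B n ω - κ n) / a n)
      atTop Z P F := by
  refine tendstoInDistribution_of_tendsto_charFun
    (fun n => ((hA.aemeasurable_rowSum n).sub_const _).div_const _) hZ fun u => ?_
  have h1 := Complex.tendsto_one_add_pow_exp_of_tendsto (hψ u)
  have h2 : Tendsto (fun n => Complex.exp (-(Complex.I * ((u * r n : ℝ) : ℂ)))) atTop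
      (𝓝 (Complex.exp (-(Complex.I * ((u * r₀ : ℝ) : ℂ))))) := by
    have hc : Continuous fun x : ℝ => Complex.exp (-(Complex.I * ((u * x : ℝ) : ℂ))) := by fun_prop
    exact (hc.tendsto r₀).comp hr
  rw [hF]
  refine (h2.mul h1).congr' ?_
  filter_upwards [hpos, ha, hκ] with n hn han hκn
  rw [hκn, hA.charFun_rowSum hn han.ne', add_sub_cancel]

end Array

/-! ### The Lindeberg condition for mixtures -/

section Moments

variable {μ ν : Measure ℝ}

lemma lindebergTerm_nonneg (ζ : Measure ℝ) (b : ℝ) {a : ℝ} (ha : 0 ≤ a) :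
    0 ≤ lindebergTerm ζ b a :=
  integral_nonneg fun z => mul_nonneg (sq_nonneg _) (le_min zero_le_one (by positivity))

lemma integral_sub_sq_eq [IsProbabilityMeasure μ] (h : MemLp id 2 μ) {b : ℝ}
    (hb : b = ∫ z, z ∂μ) : ∫ z, (z - b) ^ 2 ∂μ = ∫ z, z ^ 2 ∂μ - b ^ 2 := by
  have h1 : Integrable (fun z : ℝ => z) μ := h.integrable (by norm_num)
  have h2 : Integrable (fun z : ℝ => z ^ 2) μ := h.integrable_sq
  have : ∀ z : ℝ, (z - b) ^ 2 = z ^ 2 - (2 * b * z - b ^ 2) := fun z => by ring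
  have h3 : Integrable (fun z : ℝ => 2 * b * z - b ^ 2) μ :=
    (h1.const_mul _).sub (integrable_const _)
  simp_rw [this]
  rw [integral_sub h2 h3,
    integral_sub (h1.const_mul _) (integrable_const _), integral_const_mul, ← hb]
  simp
  ring

lemma integral_sub_sq_le [IsProbabilityMeasure μ] (h : MemLp id 2 μ) (b : ℝ) :
    ∫ z, (z - b) ^ 2 ∂μ ≤ 2 * ∫ z, z ^ 2 ∂μ + 2 * b ^ 2 := by
  have h2 : Integrable (fun z : ℝ => z ^ 2) μ := h.integrable_sq
  have : ∫ z, (2 * z ^ 2 + 2 * b ^ 2) ∂μ = 2 * ∫ z, z ^ 2 ∂μ + 2 * b ^ 2 := by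
    rw [integral_add (h2.const_mul 2) (integrable_const _), integral_const_mul]
    simp
  rw [← this]
  refine integral_mono (integrable_sub_sq h b) ((h2.const_mul 2).add (integrable_const _))
    fun z => ?_
  simp only
  nlinarith [sq_nonneg (z + b)]

lemma sq_integral_le [IsProbabilityMeasure μ] (h : MemLp id 2 μ) :
    (∫ z, z ∂μ) ^ 2 ≤ ∫ z, z ^ 2 ∂μ := by
  have h1 := integral_sub_sq_eq h rfl
  have h2 : 0 ≤ ∫ z, (z - ∫ y, y ∂μ) ^ 2 ∂μ := integral_nonneg fun z => sq_nonneg _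
  linarith

lemma lindebergTerm_le [IsProbabilityMeasure μ] (h : MemLp id 2 μ) (b : ℝ) {a : ℝ} (ha : 0 ≤ a) :
    lindebergTerm μ b a ≤ 2 * ∫ z, z ^ 2 ∂μ + 2 * b ^ 2 :=
  (integral_mono (integrable_lindeberg h b ha) (integrable_sub_sq h b) fun _ =>
    mul_le_of_le_one_right (sq_nonneg _) (min_le_left _ _)).trans (integral_sub_sq_le h b)

lemma lindebergTerm_le_of_abs_le [IsProbabilityMeasure μ] (h : MemLp id 2 μ) {b R a : ℝ}
    (ha : 0 ≤ a) (hR : ∀ᵐ z ∂μ, |z - b| ≤ R) :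
    lindebergTerm μ b a ≤ R / a * (2 * ∫ z, z ^ 2 ∂μ + 2 * b ^ 2) := by
  have hR0 : 0 ≤ R := by
    obtain ⟨z, hz⟩ := hR.exists
    exact (abs_nonneg _).trans hz
  refine le_trans ?_ (mul_le_mul_of_nonneg_left (integral_sub_sq_le h b) (by positivity))
  rw [← integral_const_mul]
  refine integral_mono_ae (integrable_lindeberg h b ha) ((integrable_sub_sq h b).const_mul _) ?_
  filter_upwards [hR] with z hz
  rw [mul_comm]
  gcongr
  exact (min_le_right _ _).trans (by gcongr)

variable {ε : ℝ}

lemma lindebergTerm_mixtureLaw [IsFiniteMeasure μ] [IsFiniteMeasure ν] (h0 : 0 ≤ ε) (h1 : ε ≤ 1)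
    (hμ : MemLp id 2 μ) (hν : MemLp id 2 ν) (b : ℝ) {a : ℝ} (ha : 0 ≤ a) :
    lindebergTerm (mixtureLaw ε μ ν) b a =
      (1 - ε) * lindebergTerm μ b a + ε * lindebergTerm ν b a := by
  rw [lindebergTerm, integral_mixtureLaw h0 h1 (integrable_lindeberg hμ b ha)
    (integrable_lindeberg hν b ha)]
  rfl

lemma mean_mixtureLaw [IsFiniteMeasure μ] [IsFiniteMeasure ν] (h0 : 0 ≤ ε) (h1 : ε ≤ 1)
    (hμ : MemLp id 2 μ) (hν : MemLp id 2 ν) :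
    ∫ z, z ∂(mixtureLaw ε μ ν) = (1 - ε) * ∫ z, z ∂μ + ε * ∫ z, z ∂ν :=
  integral_mixtureLaw h0 h1 (hμ.integrable (by norm_num)) (hν.integrable (by norm_num))

lemma sq_moment_mixtureLaw (h0 : 0 ≤ ε) (h1 : ε ≤ 1)
    (hμ : MemLp id 2 μ) (hν : MemLp id 2 ν) :
    ∫ z, z ^ 2 ∂(mixtureLaw ε μ ν) = (1 - ε) * ∫ z, z ^ 2 ∂μ + ε * ∫ z, z ^ 2 ∂ν :=
  integral_mixtureLaw h0 h1 hμ.integrable_sq hν.integrable_sq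

end Moments

/-- The Lindeberg central limit theorem for the characteristic function of one summand in an array
with identically distributed rows. -/
lemma tendsto_affineCharFun_of_lindeberg {ζ : ℕ → Measure ℝ} {b v : ℕ → ℝ}
    (hp : ∀ᶠ n in atTop, IsProbabilityMeasure (ζ n)) (h2 : ∀ᶠ n in atTop, MemLp id 2 (ζ n))
    (hb : ∀ᶠ n in atTop, b n = ∫ z, z ∂(ζ n)) (hv : ∀ᶠ n in atTop, v n = ∫ z, (z - b n) ^ 2 ∂(ζ n))
    (hv0 : ∀ᶠ n in atTop, 0 < v n)
    (hL : Tendsto (fun n : ℕ => lindebergTerm (ζ n) (b n) √(n * v n) / v n) atTop (𝓝 0)) (u : ℝ) :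
    Tendsto (fun n : ℕ => n * (affineCharFun (ζ n) (b n) √(n * v n) u - 1)) atTop
      (𝓝 (-(u ^ 2 / 2 : ℝ) : ℂ)) := by
  rw [tendsto_iff_norm_sub_tendsto_zero]
  have hlim := hL.const_mul (2 * u ^ 2 * max 1 |u|)
  rw [mul_zero] at hlim
  refine squeeze_zero' (Eventually.of_forall fun n => norm_nonneg _) ?_ hlim
  filter_upwards [hp, h2, hb, hv, hv0, eventually_gt_atTop 0] with n hp h2 hb hv hv0 hn
  have hn0 : (0 : ℝ) < n := by exact_mod_cast hn
  have ha : 0 < √(n * v n) := by positivity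
  have h := norm_integral_exp_sub_le h2 hb ha u
  rw [Real.sq_sqrt (by positivity), ← hv] at h
  have h3 : (n : ℂ) * (affineCharFun (ζ n) (b n) √(n * v n) u - 1) - (-(u ^ 2 / 2 : ℝ) : ℂ) =
      n * (affineCharFun (ζ n) (b n) √(n * v n) u - 1
        + ((u ^ 2 / (2 * (n * v n)) * v n : ℝ) : ℂ)) := by
    have h4 : u ^ 2 / (2 * (n * v n)) * v n = u ^ 2 / 2 / n := by field_simp
    have hnC : (n : ℂ) ≠ 0 := by exact_mod_cast hn.ne'
    rw [h4]
    push_cast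
    field_simp
    ring
  rw [h3, norm_mul, Complex.norm_natCast]
  refine (mul_le_mul_of_nonneg_left h hn0.le).trans (le_of_eq ?_)
  field_simp

section Mixture

variable {μ : Measure ℝ} [IsProbabilityMeasure μ] {ε : ℕ → ℝ} {ν : ℕ → Measure ℝ} {b v : ℕ → ℝ}

/-- The Lindeberg condition for mixtures whose contaminating component contributes nothing to the
variance in the limit. -/
lemma lindeberg_mixture_of_tendsto_zero (hμ : MemLp id 2 μ)
    (hσ : 0 < ∫ x, (x - ∫ y, y ∂μ) ^ 2 ∂μ)
    (hε : ∀ᶠ n in atTop, 0 ≤ ε n ∧ ε n ≤ 1) (hε0 : Tendsto ε atTop (𝓝 0))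
    (hp : ∀ᶠ n in atTop, IsProbabilityMeasure (ν n)) (h2 : ∀ᶠ n in atTop, MemLp id 2 (ν n))
    (hb : ∀ᶠ n in atTop, b n = ∫ z, z ∂(mixtureLaw (ε n) μ (ν n)))
    (hv : ∀ᶠ n in atTop, v n = ∫ z, (z - b n) ^ 2 ∂(mixtureLaw (ε n) μ (ν n)))
    (hq : Tendsto (fun n => ε n * ∫ y, y ^ 2 ∂(ν n)) atTop (𝓝 0)) :
    (∀ᶠ n in atTop, 0 < v n) ∧
      Tendsto (fun n : ℕ => lindebergTerm (mixtureLaw (ε n) μ (ν n)) (b n) √(n * v n) / v n)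
        atTop (𝓝 0) := by
  have hmean : Tendsto (fun n => ε n * ∫ y, y ∂(ν n)) atTop (𝓝 0) := by
    have hlim : Tendsto (fun n => ε n + ε n * ∫ y, y ^ 2 ∂(ν n)) atTop (𝓝 0) := by
      simpa using hε0.add hq
    refine squeeze_zero_norm' ?_ hlim
    filter_upwards [hε, hp, h2] with n hε hp h2
    rw [norm_mul, Real.norm_eq_abs, abs_of_nonneg hε.1, ← mul_one_add]
    refine mul_le_mul_of_nonneg_left ?_ hε.1
    have := sq_integral_le h2
    rw [Real.norm_eq_abs]
    nlinarith [sq_abs (∫ y, y ∂(ν n)), sq_nonneg (|∫ y, y ∂(ν n)| - 1),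
      sq_nonneg (|∫ y, y ∂(ν n)|)]
  have hε1 : Tendsto (fun n => 1 - ε n) atTop (𝓝 1) := by simpa using hε0.const_sub 1
  have hblim : Tendsto b atTop (𝓝 (∫ y, y ∂μ)) := by
    have h := (hε1.mul_const (∫ y, y ∂μ)).add hmean
    rw [one_mul, add_zero] at h
    refine h.congr' ?_
    filter_upwards [hε, hp, h2, hb] with n hε hp h2 hb
    rw [hb, mean_mixtureLaw hε.1 hε.2 hμ h2]
  have hvlim : Tendsto v atTop (𝓝 (∫ x, (x - ∫ y, y ∂μ) ^ 2 ∂μ)) := by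
    have h := ((hε1.mul_const (∫ y, y ^ 2 ∂μ)).add hq).sub (hblim.pow 2)
    rw [one_mul, add_zero, ← integral_sub_sq_eq hμ rfl] at h
    refine h.congr' ?_
    filter_upwards [hε, hp, h2, hb, hv] with n hε hp h2 hb hv
    have := isProbabilityMeasure_mixtureLaw (μ := μ) (ν := ν n) hε.1 hε.2
    rw [hv, integral_sub_sq_eq (memLp_two_mixtureLaw hμ h2) hb,
      sq_moment_mixtureLaw hε.1 hε.2 hμ h2]
  have ha : Tendsto (fun n : ℕ => √(n * v n)) atTop atTop :=
    Real.tendsto_sqrt_atTop.comp (tendsto_natCast_atTop_atTop.atTop_mul_pos hσ hvlim)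
  refine ⟨hvlim.eventually (lt_mem_nhds hσ), ?_⟩
  have hbbd : ∀ᶠ n in atTop, |b n| ≤ |∫ y, y ∂μ| + 1 :=
    hblim.abs.eventually (ge_mem_nhds (by linarith))
  have hL1 := tendsto_lindebergTerm hμ hbbd ha
  have hL2 : Tendsto (fun n : ℕ => ε n * lindebergTerm (ν n) (b n) √(n * v n)) atTop (𝓝 0) := by
    have hlim : Tendsto (fun n => 2 * (ε n * ∫ y, y ^ 2 ∂(ν n)) + 2 * (ε n * b n ^ 2)) atTop
        (𝓝 0) := by
      simpa using (hq.const_mul 2).add ((hε0.mul (hblim.pow 2)).const_mul 2)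
    refine squeeze_zero' ?_ ?_ hlim
    · filter_upwards [hε] with n hε
      exact mul_nonneg hε.1 (lindebergTerm_nonneg _ _ (Real.sqrt_nonneg _))
    · filter_upwards [hε, hp, h2] with n hε hp h2
      have := mul_le_mul_of_nonneg_left (lindebergTerm_le h2 (b n) (Real.sqrt_nonneg (n * v n)))
        hε.1
      linarith
  have h := ((hε1.mul hL1).add hL2).div hvlim hσ.ne'
  rw [mul_zero, add_zero, zero_div] at h
  refine h.congr' ?_
  filter_upwards [hε, hp, h2] with n hε hp h2
  rw [lindebergTerm_mixtureLaw hε.1 hε.2 hμ h2 _ (Real.sqrt_nonneg _)]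
  rfl

/-- The Lindeberg condition for mixtures whose contaminating component dominates the variance, and
whose truncation level `M n` is negligible with respect to the standard deviation of the sum. -/
lemma lindeberg_mixture_of_tendsto_atTop {M : ℕ → ℝ} (hμ : MemLp id 2 μ)
    (hε : ∀ᶠ n in atTop, 0 ≤ ε n ∧ ε n ≤ 1) (hε0 : Tendsto ε atTop (𝓝 0))
    (hp : ∀ᶠ n in atTop, IsProbabilityMeasure (ν n)) (h2 : ∀ᶠ n in atTop, MemLp id 2 (ν n))
    (hM : ∀ᶠ n in atTop, ∀ᵐ y ∂(ν n), |y| ≤ M n)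
    (hb : ∀ᶠ n in atTop, b n = ∫ z, z ∂(mixtureLaw (ε n) μ (ν n)))
    (hv : ∀ᶠ n in atTop, v n = ∫ z, (z - b n) ^ 2 ∂(mixtureLaw (ε n) μ (ν n)))
    (hq : Tendsto (fun n => ε n * ∫ y, y ^ 2 ∂(ν n)) atTop atTop)
    (hMq : Tendsto (fun n => M n ^ 2 / (n * (ε n * ∫ y, y ^ 2 ∂(ν n)))) atTop (𝓝 0)) :
    (∀ᶠ n in atTop, 0 < v n) ∧
      Tendsto (fun n : ℕ => lindebergTerm (mixtureLaw (ε n) μ (ν n)) (b n) √(n * v n) / v n)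
        atTop (𝓝 0) := by
  set q : ℕ → ℝ := fun n => ε n * ∫ y, y ^ 2 ∂(ν n) with hqdef
  set m := ∫ y, y ∂μ
  set s := ∫ y, y ^ 2 ∂μ
  have hs : 0 ≤ s := integral_nonneg fun y => sq_nonneg y
  -- the squared mean is negligible with respect to the second moment, because the contaminating
  -- component enters it with the factor `ε n ^ 2` and not `ε n`
  have hb2 : ∀ᶠ n in atTop, b n ^ 2 ≤ 2 * m ^ 2 + 2 * (ε n * q n) := by
    filter_upwards [hε, hp, h2, hb] with n hε hp h2 hb
    rw [hb, mean_mixtureLaw hε.1 hε.2 hμ h2]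
    have h1 : ε n ^ 2 * (∫ y, y ∂(ν n)) ^ 2 ≤ ε n ^ 2 * ∫ y, y ^ 2 ∂(ν n) :=
      mul_le_mul_of_nonneg_left (sq_integral_le h2) (sq_nonneg _)
    have h3 : (1 - ε n) ^ 2 * m ^ 2 ≤ 1 * m ^ 2 :=
      mul_le_mul_of_nonneg_right (pow_le_one₀ (by linarith) (by linarith)) (sq_nonneg _)
    change ((1 - ε n) * m + ε n * ∫ y, y ∂(ν n)) ^ 2 ≤ 2 * m ^ 2 + 2 * (ε n * (ε n * _))
    nlinarith [sq_nonneg ((1 - ε n) * m - ε n * ∫ y, y ∂(ν n))]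
  have hvq : ∀ᶠ n in atTop, q n / 2 ≤ v n := by
    filter_upwards [hε, hp, h2, hb, hv, hb2,
      hε0.eventually (ge_mem_nhds (show (0 : ℝ) < 1 / 8 by norm_num)),
      hq.eventually_ge_atTop (8 * m ^ 2), hq.eventually_ge_atTop 0]
      with n hε hp h2 hb hv hb2 hε8 hqm hq0
    have := isProbabilityMeasure_mixtureLaw (μ := μ) (ν := ν n) hε.1 hε.2
    rw [hv, integral_sub_sq_eq (memLp_two_mixtureLaw hμ h2) hb,
      sq_moment_mixtureLaw hε.1 hε.2 hμ h2]
    change q n / 2 ≤ (1 - ε n) * s + q n - b n ^ 2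
    have h1 : 0 ≤ (1 - ε n) * s := mul_nonneg (by linarith) hs
    have h3 : ε n * q n ≤ 1 / 8 * q n := mul_le_mul_of_nonneg_right hε8 hq0
    linarith
  have hv0 : ∀ᶠ n in atTop, 0 < v n := by
    filter_upwards [hvq, hq.eventually_gt_atTop 0] with n h1 h2
    linarith
  refine ⟨hv0, ?_⟩
  have hbv : Tendsto (fun n => b n ^ 2 / v n) atTop (𝓝 0) := by
    have hlim : Tendsto (fun n => 4 * m ^ 2 / q n + 4 * ε n) atTop (𝓝 0) := by
      simpa using (hq.const_div_atTop (4 * m ^ 2)).add (hε0.const_mul 4)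
    refine squeeze_zero' ?_ ?_ hlim
    · filter_upwards [hv0] with n hv0
      positivity
    · filter_upwards [hb2, hvq, hq.eventually_gt_atTop 0, hε] with n hb2 hvq hq0 hε
      have h0 : 0 ≤ 2 * m ^ 2 + 2 * (ε n * q n) := (sq_nonneg _).trans hb2
      calc b n ^ 2 / v n ≤ (2 * m ^ 2 + 2 * (ε n * q n)) / (q n / 2) := by gcongr
        _ = _ := by field_simp; ring
  have hvlim : Tendsto v atTop atTop := tendsto_atTop_mono' _ hvq (hq.atTop_div_const two_pos)
  -- the scale of the bounded part of the mixture, relative to the standard deviation of the sum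
  have hR : Tendsto (fun n : ℕ => (M n + |b n|) / √(n * v n)) atTop (𝓝 0) := by
    have hlim : Tendsto (fun n : ℕ => √(2 * (2 * (M n ^ 2 / (n * q n)) + b n ^ 2 / v n)))
        atTop (𝓝 0) := by
      have := ((hMq.const_mul 2).add hbv).const_mul 2
      simp only [mul_zero, add_zero] at this
      simpa using this.sqrt
    refine squeeze_zero' ?_ ?_ hlim
    · filter_upwards [hM, hp] with n hM hp
      obtain ⟨y, hy⟩ := hM.exists
      have : 0 ≤ M n := (abs_nonneg y).trans hy
      positivity
    · filter_upwards [hvq, hq.eventually_gt_atTop 0, eventually_ge_atTop 1] with n hvq hq0 hn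
      have hn1 : (1 : ℝ) ≤ n := by exact_mod_cast hn
      have hv0 : 0 < v n := by linarith
      refine Real.le_sqrt_of_sq_le ?_
      rw [div_pow, Real.sq_sqrt (by positivity)]
      have h1 : M n ^ 2 / (n * v n) ≤ 2 * (M n ^ 2 / (n * q n)) := by
        calc M n ^ 2 / (n * v n) ≤ M n ^ 2 / (n * (q n / 2)) := by gcongr
          _ = _ := by field_simp
      have h3 : b n ^ 2 / (n * v n) ≤ b n ^ 2 / v n := by
        gcongr
        exact le_mul_of_one_le_left hv0.le hn1
      have h4 : (M n + |b n|) ^ 2 ≤ 2 * (M n ^ 2 + b n ^ 2) := by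
        nlinarith [sq_nonneg (M n - |b n|), sq_abs (b n)]
      calc (M n + |b n|) ^ 2 / (n * v n) ≤ 2 * (M n ^ 2 + b n ^ 2) / (n * v n) := by gcongr
        _ = 2 * (M n ^ 2 / (n * v n) + b n ^ 2 / (n * v n)) := by ring
        _ ≤ _ := by gcongr
  have hlim : Tendsto (fun n : ℕ => 2 * s / v n + 2 * (b n ^ 2 / v n) +
      (M n + |b n|) / √(n * v n) * (4 + 2 * (b n ^ 2 / v n))) atTop (𝓝 0) := by
    have h1 := (hvlim.const_div_atTop (2 * s)).add (hbv.const_mul 2)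
    have h3 := hR.mul ((hbv.const_mul 2).const_add 4)
    simpa using h1.add h3
  refine squeeze_zero' ?_ ?_ hlim
  · filter_upwards [hv0] with n hv0
    exact div_nonneg (lindebergTerm_nonneg _ _ (Real.sqrt_nonneg _)) hv0.le
  · filter_upwards [hε, hp, h2, hM, hv0, hvq] with n hε hp h2 hM hv0 hvq
    have ha := Real.sqrt_nonneg (n * v n)
    have hM0 : 0 ≤ M n := by
      obtain ⟨y, hy⟩ := hM.exists
      exact (abs_nonneg y).trans hy
    rw [lindebergTerm_mixtureLaw hε.1 hε.2 hμ h2 _ ha, add_div]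
    refine add_le_add ?_ ?_
    · rw [show 2 * s / v n + 2 * (b n ^ 2 / v n) = (2 * s + 2 * b n ^ 2) / v n by ring]
      gcongr
      exact (mul_le_of_le_one_left (lindebergTerm_nonneg _ _ ha) (by linarith [hε.1])).trans
        (lindebergTerm_le hμ _ ha)
    · have h3 := lindebergTerm_le_of_abs_le h2 (b := b n) (R := M n + |b n|) ha (by
        filter_upwards [hM] with y hy
        exact (abs_sub _ _).trans (by linarith))
      have h4 := mul_le_mul_of_nonneg_left h3 hε.1
      have hR0 : 0 ≤ (M n + |b n|) / √(n * v n) := by positivity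
      have h5 : ε n * lindebergTerm (ν n) (b n) √(n * v n) ≤
          (M n + |b n|) / √(n * v n) * (4 * v n + 2 * b n ^ 2) := by
        refine h4.trans ?_
        rw [mul_left_comm]
        refine mul_le_mul_of_nonneg_left ?_ hR0
        have h6 : ε n * b n ^ 2 ≤ b n ^ 2 := mul_le_of_le_one_left (sq_nonneg _) hε.2
        have h7 : ε n * ∫ y, y ^ 2 ∂(ν n) = q n := rfl
        linarith
      calc _ ≤ (M n + |b n|) / √(n * v n) * (4 * v n + 2 * b n ^ 2) / v n := by gcongr
        _ = _ := by field_simp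

end Mixture

/-! ### Limits governed by the rescaled tails -/

lemma HasPowerTail.mono {α C D : ℝ} (hCD : C ≤ D) {ρ : Measure ℝ} (h : HasPowerTail α C ρ) :
    HasPowerTail α D ρ where
  sfinite := h.sfinite
  pos := h.pos
  tail_le x hx := (h.tail_le x hx).trans (ENNReal.ofReal_le_ofReal (by gcongr))

lemma hasPowerTail_zero (α : ℝ) : HasPowerTail α 0 (0 : Measure ℝ) where
  sfinite := inferInstance
  pos := rfl
  tail_le x _ := by simp

/-- If the rescaled tails `w_n P(Y_n > a_n x)` converge to the tails of `ρ₀`, then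
`w_n E[e^{iu Y_n / a_n} - 1]` converges to the integral of `e^{iux} - 1` against `ρ₀`. -/
lemma tendsto_weighted_integral_exp_sub_one {α C C₀ D : ℝ} (hα : α ∈ Ioo (0 : ℝ) 1)
    (hC : 0 ≤ C) (hC₀ : 0 ≤ C₀) {ν : ℕ → Measure ℝ} {w a : ℕ → ℝ} {ρ₀ : Measure ℝ}
    (hp : ∀ᶠ n in atTop, IsProbabilityMeasure (ν n))
    (hν : ∀ᶠ n in atTop, ∀ᵐ y ∂(ν n), 0 < y)
    (htail : ∀ᶠ n in atTop, ∀ x, 0 < x → (ν n).real (Ioi x) ≤ C * x ^ (-α))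
    (hw : ∀ᶠ n in atTop, 0 ≤ w n) (ha : ∀ᶠ n in atTop, 0 < a n)
    (hwa : ∀ᶠ n in atTop, w n * a n ^ (-α) ≤ D)
    (hρ₀ : HasPowerTail α C₀ ρ₀)
    (hlim : ∀ x, 0 < x →
      Tendsto (fun n => w n * (ν n).real (Ioi (a n * x))) atTop (𝓝 (ρ₀.real (Ioi x))))
    (u : ℝ) :
    Tendsto (fun n => (w n : ℂ) *
      ∫ y, (Complex.exp (Complex.I * ((u * (y / a n) : ℝ) : ℂ)) - 1) ∂(ν n)) atTop
      (𝓝 (∫ x, (Complex.exp (Complex.I * ((u * x : ℝ) : ℂ)) - 1) ∂ρ₀)) := by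
  set ρ : ℕ → Measure ℝ := fun n => ENNReal.ofReal (w n) • (ν n).map fun y => y / a n with hρ
  have hIoi : ∀ n x, 0 < a n →
      ρ n (Ioi x) = ENNReal.ofReal (w n) * ν n (Ioi (a n * x)) := by
    intro n x han
    rw [hρ, Measure.smul_apply, Measure.map_apply (by fun_prop) measurableSet_Ioi, smul_eq_mul]
    congr 2
    ext y
    simp [lt_div_iff₀' han]
  have hpow : ∀ᶠ n in atTop, HasPowerTail α (max (C * D) C₀) (ρ n) := by
    filter_upwards [hp, hν, htail, hw, ha, hwa] with n hp hν htail hw ha hwa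
    refine ⟨by simp only [hρ]; infer_instance, ?_, fun x hx => ?_⟩
    · rw [hρ, Measure.smul_apply, Measure.map_apply (by fun_prop) measurableSet_Iic]
      have : ν n ((fun y => y / a n) ⁻¹' Iic 0) = 0 := by
        rw [ae_iff] at hν
        refine measure_mono_null (fun y hy => ?_) hν
        have hy : y / a n ≤ 0 := hy
        intro hy0
        have hy0 : 0 < y := hy0
        exact absurd hy (not_le.2 (by positivity))
      rw [this, smul_zero]
    · rw [hIoi n x ha, ← ofReal_measureReal, ← ENNReal.ofReal_mul hw]
      refine ENNReal.ofReal_le_ofReal ?_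
      have hxα : 0 ≤ x ^ (-α) := by positivity
      calc w n * (ν n).real (Ioi (a n * x)) ≤ w n * (C * (a n * x) ^ (-α)) := by
            gcongr; exact htail _ (by positivity)
        _ = C * (w n * a n ^ (-α)) * x ^ (-α) := by
            rw [Real.mul_rpow ha.le hx.le]; ring
        _ ≤ C * D * x ^ (-α) := by gcongr
        _ ≤ _ := by gcongr; exact le_max_left _ _
  have h := tendsto_integral_exp_sub_one hα (hC₀.trans (le_max_right _ _)) hpow
    (hρ₀.mono (le_max_right _ _)) (fun x hx => (hlim x hx).congr' (by
      filter_upwards [hw, ha] with n hw ha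
      rw [measureReal_def (ρ n), hIoi n x ha, ENNReal.toReal_mul, ENNReal.toReal_ofReal hw]
      rfl)) u
  refine h.congr' ?_
  filter_upwards [hw] with n hw
  simp only [hρ]
  rw [integral_smul_measure, integral_map (by fun_prop) (by fun_prop), ENNReal.toReal_ofReal hw,
    Complex.real_smul]

section Bulk

variable {μ : Measure ℝ} [IsProbabilityMeasure μ]

/-- For a fixed square integrable law only the second order term of the expansion survives, and it
does so in the proportion `τ = lim n / a_n²`. -/
lemma tendsto_affineCharFun_fixed (hμ : MemLp id 2 μ) {a : ℕ → ℝ} {τ : ℝ}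
    (ha : Tendsto a atTop atTop) (hτ : Tendsto (fun n : ℕ => n / a n ^ 2) atTop (𝓝 τ)) (u : ℝ) :
    Tendsto (fun n : ℕ => n * (affineCharFun μ (∫ x, x ∂μ) (a n) u - 1)) atTop
      (𝓝 (-(τ * (u ^ 2 / 2) * ∫ x, (x - ∫ y, y ∂μ) ^ 2 ∂μ : ℝ) : ℂ)) := by
  set m := ∫ x, x ∂μ
  set V := ∫ x, (x - m) ^ 2 ∂μ
  have hL := tendsto_lindebergTerm hμ (b := fun _ => m) (C := |m|)
    (Eventually.of_forall fun _ => le_rfl) ha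
  have h1 : Tendsto (fun n : ℕ => -((n / a n ^ 2 * (u ^ 2 / 2) * V : ℝ) : ℂ)) atTop
      (𝓝 (-(τ * (u ^ 2 / 2) * V : ℝ) : ℂ)) := by
    have := ((hτ.mul_const (u ^ 2 / 2)).mul_const V)
    exact ((Complex.continuous_ofReal.tendsto _).comp this).neg
  have h2 : Tendsto (fun n : ℕ => n * (affineCharFun μ m (a n) u - 1) -
      -((n / a n ^ 2 * (u ^ 2 / 2) * V : ℝ) : ℂ)) atTop (𝓝 0) := by
    have hlim := (hτ.mul_const (2 * u ^ 2 * max 1 |u|)).mul hL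
    rw [mul_zero] at hlim
    refine squeeze_zero_norm' ?_ hlim
    filter_upwards [ha.eventually_gt_atTop 0] with n han
    have h := mul_le_mul_of_nonneg_left (norm_integral_exp_sub_le hμ (b := m) rfl han u)
      (Nat.cast_nonneg (α := ℝ) n)
    have h3 : (n : ℂ) * (affineCharFun μ m (a n) u - 1) -
        -((n / a n ^ 2 * (u ^ 2 / 2) * V : ℝ) : ℂ) =
        n * (affineCharFun μ m (a n) u - 1 + ((u ^ 2 / (2 * a n ^ 2) * V : ℝ) : ℂ)) := by
      push_cast
      ring
    rw [h3, norm_mul, Complex.norm_natCast]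
    refine h.trans (le_of_eq ?_)
    ring
  simpa using h2.add h1

/-- Asymptotics of a summand whose law is a mixture, at the scale `a_n` and centred by the mean of
the fixed component. The fixed component contributes a Gaussian term, governed by `n / a_n² → τ`;
the contaminating one contributes jumps, governed by the limit `ρ₀` of the measures
`n ε_n P(Y_n / a_n ∈ ·)`. The condition `n ε_n / a_n → 0` makes the centring of the contaminating
component irrelevant. -/
lemma tendsto_affineCharFun_mixtureLaw {α C C₀ D τ : ℝ} (hα : α ∈ Ioo (0 : ℝ) 1)
    (hC : 0 ≤ C) (hC₀ : 0 ≤ C₀) (hμ : MemLp id 2 μ)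
    {ε a : ℕ → ℝ} {ν : ℕ → Measure ℝ} {ρ₀ : Measure ℝ}
    (hε : ∀ᶠ n in atTop, 0 ≤ ε n ∧ ε n ≤ 1) (hε0 : Tendsto ε atTop (𝓝 0))
    (hp : ∀ᶠ n in atTop, IsProbabilityMeasure (ν n))
    (hν : ∀ᶠ n in atTop, ∀ᵐ y ∂(ν n), 0 < y)
    (htail : ∀ᶠ n in atTop, ∀ x, 0 < x → (ν n).real (Ioi x) ≤ C * x ^ (-α))
    (ha : Tendsto a atTop atTop) (hτ : Tendsto (fun n : ℕ => n / a n ^ 2) atTop (𝓝 τ))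
    (hwa : ∀ᶠ n : ℕ in atTop, n * ε n * a n ^ (-α) ≤ D)
    (hw : Tendsto (fun n : ℕ => n * ε n / a n) atTop (𝓝 0))
    (hρ₀ : HasPowerTail α C₀ ρ₀)
    (hlim : ∀ x, 0 < x →
      Tendsto (fun n : ℕ => n * ε n * (ν n).real (Ioi (a n * x))) atTop (𝓝 (ρ₀.real (Ioi x))))
    (u : ℝ) :
    Tendsto (fun n : ℕ =>
      n * (affineCharFun (mixtureLaw (ε n) μ (ν n)) (∫ x, x ∂μ) (a n) u - 1)) atTop
      (𝓝 (-(τ * (u ^ 2 / 2) * ∫ x, (x - ∫ y, y ∂μ) ^ 2 ∂μ : ℝ) +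
        ∫ x, (Complex.exp (Complex.I * ((u * x : ℝ) : ℂ)) - 1) ∂ρ₀)) := by
  set m := ∫ x, x ∂μ
  have hX := tendsto_affineCharFun_fixed hμ ha hτ u
  have hY := tendsto_weighted_integral_exp_sub_one hα hC hC₀ hp hν htail
    (by filter_upwards [hε] with n hε using mul_nonneg (Nat.cast_nonneg n) hε.1)
    (ha.eventually_gt_atTop 0) hwa hρ₀ hlim u
  have hphase : Tendsto (fun n : ℕ => Complex.exp (Complex.I * ((-u * m / a n : ℝ) : ℂ))) atTop
      (𝓝 1) := by
    have hc : Continuous fun x : ℝ => Complex.exp (Complex.I * (x : ℂ)) := by fun_prop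
    simpa [Function.comp_def] using (hc.tendsto 0).comp (ha.const_div_atTop (-u * m))
  have hshift : Tendsto (fun n : ℕ => ((n * ε n : ℝ) : ℂ) *
      (Complex.exp (Complex.I * ((-u * m / a n : ℝ) : ℂ)) - 1)) atTop (𝓝 0) := by
    have hl := hw.mul_const (|u * m|)
    rw [zero_mul] at hl
    refine squeeze_zero_norm' ?_ hl
    filter_upwards [hε, ha.eventually_gt_atTop 0] with n hε han
    have hw0 : 0 ≤ n * ε n := mul_nonneg (Nat.cast_nonneg n) hε.1
    rw [norm_mul, Complex.norm_real, Real.norm_eq_abs, abs_of_nonneg hw0]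
    refine (mul_le_mul_of_nonneg_left (norm_exp_I_mul_sub_one_le _) hw0).trans (le_of_eq ?_)
    rw [abs_div, abs_of_pos han, neg_mul, abs_neg]
    ring
  have hε1 : Tendsto (fun n => ((1 - ε n : ℝ) : ℂ)) atTop (𝓝 1) := by
    have := (Complex.continuous_ofReal.tendsto _).comp (hε0.const_sub 1)
    simpa [Function.comp_def] using this
  have h := (hε1.mul hX).add ((hphase.mul hY).add hshift)
  rw [one_mul, one_mul, add_zero] at h
  refine h.congr' ?_
  filter_upwards [hε, hp] with n hε hp
  have hint : ∀ (ξ : Measure ℝ) [IsProbabilityMeasure ξ], Integrable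
      (fun z : ℝ => Complex.exp (Complex.I * ((u * ((z - m) / a n) : ℝ) : ℂ))) ξ := by
    intro ξ _
    refine Integrable.of_bound (by fun_prop) 1 (ae_of_all _ fun z => ?_)
    rw [Complex.norm_exp_I_mul_ofReal]
  have hint' : Integrable
      (fun y : ℝ => Complex.exp (Complex.I * ((u * (y / a n) : ℝ) : ℂ))) (ν n) := by
    refine Integrable.of_bound (by fun_prop) 1 (ae_of_all _ fun z => ?_)
    rw [Complex.norm_exp_I_mul_ofReal]
  have e1 : affineCharFun (mixtureLaw (ε n) μ (ν n)) m (a n) u =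
      ((1 - ε n : ℝ) : ℂ) * affineCharFun μ m (a n) u +
        (ε n : ℂ) * affineCharFun (ν n) m (a n) u := by
    rw [affineCharFun, integral_mixtureLaw hε.1 hε.2 (hint μ) (hint (ν n)), Complex.real_smul,
      Complex.real_smul]
    rfl
  have e2 : affineCharFun (ν n) m (a n) u = Complex.exp (Complex.I * ((-u * m / a n : ℝ) : ℂ)) *
      ((∫ y, (Complex.exp (Complex.I * ((u * (y / a n) : ℝ) : ℂ)) - 1) ∂(ν n)) + 1) := by
    rw [integral_sub hint' (integrable_const 1), integral_const, probReal_univ, one_smul,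
      sub_add_cancel, ← integral_const_mul, affineCharFun]
    congr 1
    ext y
    rw [← Complex.exp_add]
    congr 1
    push_cast
    ring
  rw [e1, e2]
  push_cast
  ring

end Bulk

/-- Existence of the one-sided stable law, as the limit of normalized sums of independent variables
with the given heavy-tailed law. -/
lemma IsHeavyTail.exists_stable {α : ℝ} (hα : α ∈ Ioo (0 : ℝ) 1) {μ₂ : Measure ℝ}
    (h : IsHeavyTail α μ₂) {c : ℝ} (hc : 0 < c) :
    ∃ F : ProbabilityMeasure ℝ, IsOneSidedStable α (α * c ^ (-α)) (F : Measure ℝ) ∧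
      ∀ u, charFun (F : Measure ℝ) u = Complex.exp (stableExponent α (α * c ^ (-α)) u) := by
  have := h.prob
  have hs : 0 < α * c ^ (-α) := mul_pos hα.1 (Real.rpow_pos_of_pos hc _)
  obtain ⟨C, hC, hle⟩ := h.exists_tail_le hα.1
  set a : ℕ → ℝ := fun n => c * (n : ℝ) ^ (1 / α) with ha
  have ha0 : ∀ n, 0 ≤ a n := fun n => by positivity
  have hapos : ∀ n : ℕ, 0 < n → 0 < a n := fun n hn => by
    have : (0 : ℝ) < n := by exact_mod_cast hn
    positivity
  have hapow : ∀ n : ℕ, 0 < n → n * a n ^ (-α) = c ^ (-α) := fun n hn => by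
    have hn0 : (0 : ℝ) < n := by exact_mod_cast hn
    rw [ha, Real.mul_rpow hc.le (by positivity), ← Real.rpow_mul hn0.le, mul_neg,
      one_div_mul_cancel hα.1.ne', Real.rpow_neg_one]
    field_simp
  have halim : Tendsto a atTop atTop :=
    ((tendsto_rpow_atTop (one_div_pos.2 hα.1)).comp tendsto_natCast_atTop_atTop).const_mul_atTop hc
  have htail : ∀ x, 0 < x → Tendsto (fun n : ℕ => (n : ℝ) * μ₂.real (Ioi (a n * x))) atTop
      (𝓝 ((oneSidedLevyMeasure α (α * c ^ (-α))).real (Ioi x))) := by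
    intro x hx
    have h1 := (h.tendsto_tail.comp (halim.atTop_mul_const hx)).const_mul (c ^ (-α) * x ^ (-α))
    rw [measureReal_def, oneSidedLevyMeasure_Ioi hα.1 hs.le hx,
      ENNReal.toReal_ofReal (by have := hα.1; positivity), mul_div_cancel_left₀ _ hα.1.ne']
    rw [mul_one] at h1
    refine h1.congr' ?_
    filter_upwards [eventually_gt_atTop 0] with n hn
    have han := hapos n hn
    have e1 : x ^ (-α) * x ^ α = 1 := by rw [← Real.rpow_add hx]; simp
    have e2 : a n ^ (-α) * a n ^ α = 1 := by rw [← Real.rpow_add han]; simp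
    simp only [Function.comp_apply]
    rw [← hapow n hn, Real.mul_rpow han.le hx.le]
    linear_combination (n * μ₂.real (Ioi (a n * x))) * (a n ^ (-α) * a n ^ α * e1 + e2)
  have hρ₀ := hasPowerTail_oneSidedLevyMeasure hα.1 hs.le
  have hlim := fun u => tendsto_weighted_integral_exp_sub_one (ν := fun _ => μ₂)
    (w := fun n => n) (a := a) (D := c ^ (-α)) hα hC.le (by have := hα.1; positivity)
    (Eventually.of_forall fun _ => this)
    (Eventually.of_forall fun _ => h.ae_one_le.mono fun y hy => zero_lt_one.trans_le hy)
    (Eventually.of_forall fun _ => hle) (Eventually.of_forall fun n => Nat.cast_nonneg n)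
    (by filter_upwards [eventually_gt_atTop 0] with n hn using hapos n hn)
    (by filter_upwards [eventually_gt_atTop 0] with n hn using (hapow n hn).le) hρ₀ htail u
  have hmap : ∀ n, IsProbabilityMeasure (μ₂.map fun y => y / a n) := fun n =>
    Measure.isProbabilityMeasure_map (by fun_prop)
  have hsum := fun n : ℕ => isProbabilityMeasure_iidSumLaw n (μ₂.map fun y => y / a n)
  obtain ⟨F, hF, hF0⟩ := exists_probabilityMeasure_charFun_eq
    (p := fun n => ⟨iidSumLaw n (μ₂.map fun y => y / a n), hsum n⟩)
    (φ := fun u => Complex.exp (stableExponent α (α * c ^ (-α)) u))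
    ((continuousAt_stableExponent hα.1 hs.le).cexp) (fun u => by
      have h1 := Complex.tendsto_one_add_pow_exp_of_tendsto (hlim u)
      refine h1.congr fun n => ?_
      simp only [ProbabilityMeasure.coe_mk]
      rw [charFun_iidSumLaw, charFun_apply_real, integral_map (by fun_prop) (by fun_prop),
        integral_sub _ (integrable_const _)]
      · simp only [integral_const, probReal_univ, one_smul, add_sub_cancel]
        congr 2
        ext y
        push_cast
        ring_nf
      · refine Integrable.of_bound (by fun_prop) 1 (ae_of_all _ fun z => ?_)
        rw [Complex.norm_exp_I_mul_ofReal]) (fun n => by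
      simp only [ProbabilityMeasure.coe_mk]
      rw [iidSumLaw, Measure.map_apply (by fun_prop) measurableSet_Iio]
      have hnn : ∀ᵐ y ∂(μ₂.map fun y => y / a n), 0 ≤ y := by
        rw [ae_map_iff (by fun_prop) measurableSet_Ici]
        filter_upwards [h.ae_one_le] with y hy
        exact div_nonneg (zero_le_one.trans hy) (ha0 n)
      have hall : ∀ᵐ x ∂(Measure.pi fun _ : Fin n => μ₂.map fun y => y / a n),
          ∀ i, 0 ≤ x i := by
        refine ae_all_iff.2 fun i => ?_
        exact (Measure.quasiMeasurePreserving_eval (fun _ : Fin n => μ₂.map fun y => y / a n)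
          i).ae hnn
      rw [ae_iff] at hall
      refine measure_mono_null (fun x hx => ?_) hall
      intro hx0
      have hx : ∑ i, x i < 0 := hx
      exact absurd hx (not_lt.2 (Finset.sum_nonneg fun i _ => hx0 i)))
  exact ⟨F, ⟨hF0, isStableLaw_of_charFun hα hs hF, isInfDivisible_of_charFun hα hs hF,
    hasLevyTriplet_of_charFun hα hs.le hF⟩, hF⟩

/-! ### The three regimes -/

lemma tendsto_natCast_rpow_atTop {p : ℝ} (hp : 0 < p) :
    Tendsto (fun n : ℕ => (n : ℝ) ^ p) atTop atTop :=
  (tendsto_rpow_atTop hp).comp tendsto_natCast_atTop_atTop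

lemma tendsto_natCast_rpow_zero {p : ℝ} (hp : p < 0) :
    Tendsto (fun n : ℕ => (n : ℝ) ^ p) atTop (𝓝 0) := by
  have := (tendsto_rpow_neg_atTop (neg_pos.2 hp)).comp tendsto_natCast_atTop_atTop
  simpa [Function.comp_def] using this

lemma eventually_natCast_pos : ∀ᶠ n : ℕ in atTop, (0 : ℝ) < n :=
  (eventually_gt_atTop 0).mono fun n hn => by exact_mod_cast hn

lemma eventually_natCast_rpow_neg_mem {γ : ℝ} (hγ : 0 < γ) :
    ∀ᶠ n : ℕ in atTop, 0 ≤ (n : ℝ) ^ (-γ) ∧ (n : ℝ) ^ (-γ) ≤ 1 := by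
  filter_upwards [eventually_ge_atTop 1] with n hn
  exact ⟨by positivity, Real.rpow_le_one_of_one_le_of_nonpos (by exact_mod_cast hn) (by linarith)⟩

lemma eventually_half_lt_real_Iic {α γ₁ : ℝ} {μ₂ : Measure ℝ} (hμ₂ : IsHeavyTail α μ₂)
    (hγ₁ : 0 < γ₁) : ∀ᶠ n : ℕ in atTop, 1 / 2 < μ₂.real (Iic ((n : ℝ) ^ γ₁)) :=
  (hμ₂.tendsto_real_Iic.comp (tendsto_natCast_rpow_atTop hγ₁)).eventually
    (lt_mem_nhds (by norm_num))

/-- The truncation at most doubles the tails, once the truncation level is above the median. -/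
lemma IsHeavyTail.exists_truncatedLaw_tail_le {α γ₁ : ℝ} {μ₂ : Measure ℝ} (h : IsHeavyTail α μ₂)
    (hα : 0 < α) (hγ₁ : 0 < γ₁) :
    ∃ C, 0 < C ∧ ∀ᶠ n : ℕ in atTop, ∀ x, 0 < x →
      (truncatedLaw μ₂ ((n : ℝ) ^ γ₁)).real (Ioi x) ≤ C * x ^ (-α) := by
  have := h.prob
  obtain ⟨C, hC, hle⟩ := h.exists_tail_le hα
  refine ⟨2 * C, by positivity, ?_⟩
  filter_upwards [eventually_half_lt_real_Iic h hγ₁] with n hn x hx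
  refine ENNReal.toReal_le_of_le_ofReal (by positivity) ((truncatedLaw_Ioi_le hn.le x).trans ?_)
  refine ENNReal.ofReal_le_ofReal ?_
  linarith [hle x hx]

lemma charFun_gaussianReal_std (u : ℝ) : charFun ((gaussianReal 0 1).map (id : ℝ → ℝ)) u =
    Complex.exp (-(Complex.I * ((u * (0 : ℝ) : ℝ) : ℂ))) * Complex.exp (-(u ^ 2 / 2 : ℝ) : ℂ) := by
  rw [Measure.map_id, charFun_gaussianReal]
  simp

section

variable {α lam γ₁ γ₂ : ℝ} {μ₁ μ₂ : Measure ℝ} {Ω : ℕ → Type*} [∀ n, MeasurableSpace (Ω n)]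
  {P : (n : ℕ) → Measure (Ω n)} [∀ n, IsProbabilityMeasure (P n)] {X Y B : (n : ℕ) → ℕ → Ω n → ℝ}

lemma variance_eq_of_hasLaw {Ω' : Type*} [MeasurableSpace Ω'] {Q : Measure Ω'} {W : Ω' → ℝ}
    {ζ : Measure ℝ} (h : HasLaw W ζ Q) :
    variance W Q = ∫ z, (z - ∫ y, y ∂ζ) ^ 2 ∂ζ := by
  rw [h.variance_eq, variance_eq_integral aemeasurable_id]
  rfl

lemma memLp_of_hasLaw {Ω' : Type*} [MeasurableSpace Ω'] {Q : Measure Ω'} {W : Ω' → ℝ}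
    {ζ : Measure ℝ} (h : HasLaw W ζ Q) (h2 : MemLp id 2 ζ) : MemLp W 2 Q := by
  rw [← h.map_eq] at h2
  exact (memLp_map_measure_iff aestronglyMeasurable_id h.aemeasurable).1 h2

lemma IsMixtureArray.eventually_hasLaw_mix (hA : IsMixtureArray μ₁ μ₂ γ₁ γ₂ P X Y B)
    (hμ₂ : IsHeavyTail α μ₂) (hγ₁ : 0 < γ₁) :
    ∀ᶠ n : ℕ in atTop, 0 < μ₂ (Iic ((n : ℝ) ^ γ₁)) ∧
      HasLaw (mix (X n 0) (Y n 0) (B n 0)) (rowLaw μ₁ μ₂ γ₁ γ₂ n) (P n) := by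
  filter_upwards [eventually_half_lt_real_Iic hμ₂ hγ₁, eventually_gt_atTop 0] with n hn hn0
  have hpos : 0 < μ₂ (Iic ((n : ℝ) ^ γ₁)) := by
    refine pos_iff_ne_zero.2 fun h => ?_
    rw [measureReal_def, h, ENNReal.toReal_zero] at hn
    linarith
  exact ⟨hpos, hA.hasLaw_mix hn0 hpos⟩

/-- Central limit theorem with the centring and the norming of the row sums themselves. The quantity
`ε_n E[Y²]` is of order `n^{(2-α)γ₁-γ₂}`, and tends to `0` or to `∞` in the two cases; in the second
case `M_n²` is small compared with `n ε_n E[Y²]` because `γ₂ < 1 - α γ₁`. -/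
lemma IsMixtureArray.tendstoInDistribution_gaussian_self (hα : α ∈ Ioo (0 : ℝ) 1)
    (hlam : 0 < lam) (hγ₁ : 0 < γ₁) (hγ₂ : 0 < γ₂) (hμ₁ : IsLightTail lam μ₁)
    (hμ₂ : IsHeavyTail α μ₂) (hA : IsMixtureArray μ₁ μ₂ γ₁ γ₂ P X Y B)
    (h : (2 - α) * γ₁ < γ₂ ∨ γ₂ < min ((2 - α) * γ₁) (1 - α * γ₁)) :
    TendstoInDistribution
      (fun (n : ℕ) (ω : Ω n) =>
        (rowSum X Y B n ω - n * ∫ ω', mix (X n 0) (Y n 0) (B n 0) ω' ∂(P n)) /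
          √(n * variance (mix (X n 0) (Y n 0) (B n 0)) (P n)))
      atTop (id : ℝ → ℝ) P (gaussianReal 0 1) := by
  have := hμ₁.prob
  have := hμ₂.prob
  have hlaw := hA.eventually_hasLaw_mix hμ₂ hγ₁
  have hM := tendsto_natCast_rpow_atTop hγ₁
  have hε := eventually_natCast_rpow_neg_mem hγ₂
  have hε0 := tendsto_natCast_rpow_zero (neg_lt_zero.2 hγ₂)
  have hμ2 := hμ₁.memLp_two hlam
  have hp : ∀ᶠ n : ℕ in atTop, IsProbabilityMeasure (truncatedLaw μ₂ ((n : ℝ) ^ γ₁)) :=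
    (eventually_half_lt_real_Iic hμ₂ hγ₁).mono fun n hn =>
      isProbabilityMeasure_truncatedLaw (by linarith)
  have h2 : ∀ᶠ n : ℕ in atTop, MemLp id 2 (truncatedLaw μ₂ ((n : ℝ) ^ γ₁)) :=
    Eventually.of_forall fun n => hμ₂.memLp_truncatedLaw _
  have hb : ∀ᶠ n : ℕ in atTop, ∫ ω', mix (X n 0) (Y n 0) (B n 0) ω' ∂(P n) =
      ∫ z, z ∂(rowLaw μ₁ μ₂ γ₁ γ₂ n) := hlaw.mono fun n hn => hn.2.integral_eq
  have hv : ∀ᶠ n : ℕ in atTop, variance (mix (X n 0) (Y n 0) (B n 0)) (P n) =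
      ∫ z, (z - ∫ ω', mix (X n 0) (Y n 0) (B n 0) ω' ∂(P n)) ^ 2 ∂(rowLaw μ₁ μ₂ γ₁ γ₂ n) := by
    filter_upwards [hlaw, hb] with n hn hb
    rw [variance_eq_of_hasLaw hn.2, hb]
  obtain ⟨hv0, hL⟩ : (∀ᶠ n : ℕ in atTop, 0 < variance (mix (X n 0) (Y n 0) (B n 0)) (P n)) ∧
      Tendsto (fun n : ℕ => lindebergTerm (rowLaw μ₁ μ₂ γ₁ γ₂ n)
        (∫ ω', mix (X n 0) (Y n 0) (B n 0) ω' ∂(P n))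
        √(n * variance (mix (X n 0) (Y n 0) (B n 0)) (P n)) /
          variance (mix (X n 0) (Y n 0) (B n 0)) (P n)) atTop (𝓝 0) := by
    rcases h with h | h
    · refine lindeberg_mixture_of_tendsto_zero hμ2 (hμ₁.variance_pos hlam) hε hε0 hp h2 hb hv ?_
      obtain ⟨C, hC, hle⟩ := hμ₂.exists_integral_sq_le hα
      have hlim := (tendsto_natCast_rpow_zero
        (show (2 - α) * γ₁ - γ₂ < 0 by linarith)).const_mul C
      rw [mul_zero] at hlim
      refine squeeze_zero' ?_ ?_ hlim
      · filter_upwards [hε] with n hε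
        exact mul_nonneg hε.1 (integral_nonneg fun y => sq_nonneg y)
      · filter_upwards [hε, hM.eventually hle, eventually_natCast_pos] with n hε hle hn
        refine (mul_le_mul_of_nonneg_left hle hε.1).trans (le_of_eq ?_)
        rw [← Real.rpow_mul hn.le, sub_eq_add_neg ((2 - α) * γ₁), Real.rpow_add hn,
          mul_comm γ₁]
        ring
    · obtain ⟨h1, h3⟩ := lt_min_iff.1 h
      obtain ⟨c, hc, hle⟩ := hμ₂.exists_le_integral_sq hα
      have hqle : ∀ᶠ n : ℕ in atTop, c * (n : ℝ) ^ ((2 - α) * γ₁ - γ₂) ≤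
          (n : ℝ) ^ (-γ₂) * ∫ y, y ^ 2 ∂(truncatedLaw μ₂ ((n : ℝ) ^ γ₁)) := by
        filter_upwards [hε, hM.eventually hle, eventually_natCast_pos] with n hε hle hn
        refine le_trans (le_of_eq ?_) (mul_le_mul_of_nonneg_left hle hε.1)
        rw [← Real.rpow_mul hn.le, sub_eq_add_neg ((2 - α) * γ₁), Real.rpow_add hn,
          mul_comm γ₁]
        ring
      refine lindeberg_mixture_of_tendsto_atTop (M := fun n => (n : ℝ) ^ γ₁) hμ2 hε hε0 hp h2
        ?_ hb hv ?_ ?_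
      · refine Eventually.of_forall fun n => ?_
        filter_upwards [hμ₂.ae_mem_Icc ((n : ℝ) ^ γ₁)] with y hy
        rw [abs_of_nonneg (zero_le_one.trans hy.1)]
        exact hy.2
      · exact tendsto_atTop_mono' _ hqle
          ((tendsto_natCast_rpow_atTop (by linarith)).const_mul_atTop hc)
      · have hlim := (tendsto_natCast_rpow_zero
          (show α * γ₁ + γ₂ - 1 < 0 by linarith)).const_mul c⁻¹
        rw [mul_zero] at hlim
        refine squeeze_zero' ?_ ?_ hlim
        · filter_upwards [hε] with n hε
          have : 0 ≤ ∫ y, y ^ 2 ∂(truncatedLaw μ₂ ((n : ℝ) ^ γ₁)) :=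
            integral_nonneg fun y => sq_nonneg y
          have := hε.1
          positivity
        · filter_upwards [hqle, eventually_natCast_pos] with n hqle hn
          calc _ ≤ ((n : ℝ) ^ γ₁) ^ 2 / (n * (c * (n : ℝ) ^ ((2 - α) * γ₁ - γ₂))) := by gcongr
            _ = c⁻¹ * (n : ℝ) ^ (α * γ₁ + γ₂ - 1) := by
              have e : ((n : ℝ) ^ γ₁) ^ 2 =
                  n * (n : ℝ) ^ ((2 - α) * γ₁ - γ₂) * (n : ℝ) ^ (α * γ₁ + γ₂ - 1) := by
                rw [← Real.rpow_mul_natCast hn.le, mul_assoc, ← Real.rpow_add hn,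
                  ← Real.rpow_one_add' hn.le]
                · congr 1
                  push_cast
                  ring
                · have := hγ₁.ne'
                  intro h0
                  apply this
                  linarith
              rw [e]
              field_simp
  have ha : ∀ᶠ n : ℕ in atTop, 0 < √(n * variance (mix (X n 0) (Y n 0) (B n 0)) (P n)) := by
    filter_upwards [hv0, eventually_natCast_pos] with n hv0 hn
    positivity
  exact hA.tendstoInDistribution (hlaw.mono fun n hn => hn.1) (r := fun _ => 0) ha
    (Eventually.of_forall fun n => by simp) tendsto_const_nhds
    (tendsto_affineCharFun_of_lindeberg
      (by filter_upwards [hε, hp] with n hε hp using isProbabilityMeasure_mixtureLaw hε.1 hε.2)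
      (h2.mono fun n hn => memLp_two_mixtureLaw hμ2 hn) hb hv hv0 hL)
    aemeasurable_id charFun_gaussianReal_std

/-- Central limit theorem with the centring and the norming of the light-tailed component: at the
scale `√n` the expected number of visible heavy-tailed variables, which is of order
`n^{1-γ₂-α/2}`, tends to `0`. -/
lemma IsMixtureArray.tendstoInDistribution_gaussian_light (hα : α ∈ Ioo (0 : ℝ) 1)
    (hlam : 0 < lam) (hγ₁ : 0 < γ₁) (hγ₂ : 0 < γ₂) (hμ₁ : IsLightTail lam μ₁)
    (hμ₂ : IsHeavyTail α μ₂) (hA : IsMixtureArray μ₁ μ₂ γ₁ γ₂ P X Y B)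
    (h : 1 - α / 2 < γ₂) :
    TendstoInDistribution
      (fun (n : ℕ) (ω : Ω n) =>
        (rowSum X Y B n ω - n * ∫ ω', X n 0 ω' ∂(P n)) / √(n * variance (X n 0) (P n)))
      atTop (id : ℝ → ℝ) P (gaussianReal 0 1) := by
  have := hμ₁.prob
  have := hμ₂.prob
  have hα0 := hα.1
  have hμ2 := hμ₁.memLp_two hlam
  have hV := hμ₁.variance_pos hlam
  set V := ∫ x, (x - ∫ y, y ∂μ₁) ^ 2 ∂μ₁ with hVdef
  set a : ℕ → ℝ := fun n => √(n * V) with ha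
  have hmean : ∀ᶠ n : ℕ in atTop, ∫ ω', X n 0 ω' ∂(P n) = ∫ x, x ∂μ₁ := by
    filter_upwards [eventually_gt_atTop 0] with n hn using (hA.law_X n 0 hn).integral_eq
  have hvar : ∀ᶠ n : ℕ in atTop, √(n * variance (X n 0) (P n)) = a n := by
    filter_upwards [eventually_gt_atTop 0] with n hn
    rw [variance_eq_of_hasLaw (hA.law_X n 0 hn)]
  have halim : Tendsto a atTop atTop :=
    Real.tendsto_sqrt_atTop.comp (tendsto_natCast_atTop_atTop.atTop_mul_const hV)
  obtain ⟨C, hC, htail⟩ := hμ₂.exists_truncatedLaw_tail_le hα.1 hγ₁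
  have hε := eventually_natCast_rpow_neg_mem hγ₂
  have hwa : Tendsto (fun n : ℕ => n * (n : ℝ) ^ (-γ₂) * a n ^ (-α)) atTop (𝓝 0) := by
    have hlim := (tendsto_natCast_rpow_zero
      (show 1 - γ₂ - α / 2 < 0 by linarith)).const_mul (V ^ (-α / 2))
    rw [mul_zero] at hlim
    refine hlim.congr' ?_
    filter_upwards [eventually_natCast_pos] with n hn
    have e : (n : ℝ) ^ (1 - γ₂ - α / 2) = n * (n : ℝ) ^ (-γ₂) * (n : ℝ) ^ (-α / 2) := by
      rw [show 1 - γ₂ - α / 2 = 1 + -γ₂ + -α / 2 by ring, Real.rpow_add hn, Real.rpow_add hn,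
        Real.rpow_one]
    rw [show a n = √(n * V) from rfl, Real.sqrt_eq_rpow, ← Real.rpow_mul (by positivity),
      Real.mul_rpow hn.le hV.le,
      show 1 / 2 * -α = -α / 2 by ring, e]
    ring
  have hw : Tendsto (fun n : ℕ => n * (n : ℝ) ^ (-γ₂) / a n) atTop (𝓝 0) := by
    have hlim := (tendsto_natCast_rpow_zero
      (show 1 - γ₂ - 1 / 2 < 0 by linarith [hα.2])).const_mul ((√V)⁻¹)
    rw [mul_zero] at hlim
    refine hlim.congr' ?_
    filter_upwards [eventually_natCast_pos] with n hn
    have e : (n : ℝ) ^ (1 - γ₂ - 1 / 2) * √n = n * (n : ℝ) ^ (-γ₂) := by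
      rw [Real.sqrt_eq_rpow, ← Real.rpow_add hn, show 1 - γ₂ - 1 / 2 + 1 / 2 = 1 + -γ₂ by ring,
        Real.rpow_add hn, Real.rpow_one]
    rw [show a n = √(n * V) from rfl, Real.sqrt_mul hn.le, ← e]
    field_simp
  have hτ : Tendsto (fun n : ℕ => n / a n ^ 2) atTop (𝓝 (1 / V)) := by
    refine tendsto_const_nhds.congr' ?_
    filter_upwards [eventually_natCast_pos] with n hn
    rw [ha, Real.sq_sqrt (by positivity)]
    field_simp
  have hlim : ∀ x : ℝ, 0 < x → Tendsto (fun n : ℕ => n * (n : ℝ) ^ (-γ₂) *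
      (truncatedLaw μ₂ ((n : ℝ) ^ γ₁)).real (Ioi (a n * x))) atTop
      (𝓝 ((0 : Measure ℝ).real (Ioi x))) := by
    intro x hx
    have hl := hwa.mul_const (C * x ^ (-α))
    rw [zero_mul] at hl
    rw [measureReal_zero_apply]
    refine squeeze_zero' ?_ ?_ hl
    · filter_upwards [hε] with n hε
      have := hε.1
      positivity
    · filter_upwards [hε, htail, halim.eventually_gt_atTop 0] with n hε htail han
      have h1 := htail (a n * x) (by positivity)
      have h2 : (0 : ℝ) ≤ n * (n : ℝ) ^ (-γ₂) := mul_nonneg (Nat.cast_nonneg n) hε.1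
      rw [Real.mul_rpow han.le hx.le] at h1
      refine (mul_le_mul_of_nonneg_left h1 h2).trans (le_of_eq ?_)
      ring
  have hmain := tendsto_affineCharFun_mixtureLaw (D := 1) hα (by positivity) le_rfl hμ2 hε
    (tendsto_natCast_rpow_zero (neg_lt_zero.2 hγ₂))
    ((eventually_half_lt_real_Iic hμ₂ hγ₁).mono fun n hn =>
      isProbabilityMeasure_truncatedLaw (by linarith))
    (Eventually.of_forall fun n => (hμ₂.ae_mem_Icc ((n : ℝ) ^ γ₁)).mono fun y hy =>
      zero_lt_one.trans_le hy.1)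
    htail halim hτ (hwa.eventually (ge_mem_nhds zero_lt_one)) hw (hasPowerTail_zero α) hlim
  refine hA.tendstoInDistribution (b := fun _ => ∫ x, x ∂μ₁) (r := fun _ => 0) (r₀ := 0)
    (ψ := fun u => (-(u ^ 2 / 2 : ℝ) : ℂ))
    ((hA.eventually_hasLaw_mix hμ₂ hγ₁).mono fun n hn => hn.1) ?_ ?_ tendsto_const_nhds
    (fun u => ?_) aemeasurable_id charFun_gaussianReal_std
  · filter_upwards [hvar, halim.eventually_gt_atTop 0] with n h1 h2
    rwa [h1]
  · filter_upwards [hmean] with n hn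
    rw [hn]; ring
  · have h1 := hmain u
    rw [integral_zero_measure, add_zero, ← hVdef,
      show 1 / V * (u ^ 2 / 2) * V = u ^ 2 / 2 by field_simp] at h1
    refine h1.congr' ?_
    filter_upwards [hvar] with n hn
    rw [hn]
    rfl

/-- Convergence to the one-sided stable law. The fluctuations of the light-tailed variables are
negligible at the scale `c n^{(1-γ₂)/α}`, as `(1-γ₂)/α > 1/2`, and so is the truncation, as
`(1-γ₂)/α < γ₁`. -/
lemma IsMixtureArray.tendstoInDistribution_stable (hα : α ∈ Ioo (0 : ℝ) 1)
    (hlam : 0 < lam) (hγ₁ : 0 < γ₁) (hγ₂ : 0 < γ₂) (hμ₁ : IsLightTail lam μ₁)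
    (hμ₂ : IsHeavyTail α μ₂) (hA : IsMixtureArray μ₁ μ₂ γ₁ γ₂ P X Y B)
    (h1 : 1 - α * γ₁ < γ₂) (h2 : γ₂ < 1 - α / 2) {c : ℝ} (hc : 0 < c) :
    ∃ F : ProbabilityMeasure ℝ,
      IsOneSidedStable α (α * c ^ (-α)) (F : Measure ℝ) ∧
      TendstoInDistribution
        (fun (n : ℕ) (ω : Ω n) =>
          (rowSum X Y B n ω - kappa α γ₂ c (∫ ω', X n 0 ω' ∂(P n)) n) /
            (c * (n : ℝ) ^ ((1 - γ₂) / α)))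
        atTop (fun x : ℝ => x - limitShift α γ₂) P (F : Measure ℝ) := by
  have := hμ₁.prob
  have := hμ₂.prob
  have hα0 := hα.1
  have hμ2 := hμ₁.memLp_two hlam
  obtain ⟨F, hF, hFchar⟩ := hμ₂.exists_stable hα hc
  refine ⟨F, hF, ?_⟩
  have hs : 0 ≤ α * c ^ (-α) := by positivity
  set p := (1 - γ₂) / α with hp
  have hpα : p * α = 1 - γ₂ := div_mul_cancel₀ _ hα0.ne'
  have hp2 : 1 / 2 < p := by
    rw [hp, lt_div_iff₀ hα0]; linarith
  have hpγ : p < γ₁ := by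
    rw [hp, div_lt_iff₀ hα0]; linarith
  set a : ℕ → ℝ := fun n => c * (n : ℝ) ^ p with ha
  set m := ∫ x, x ∂μ₁ with hm
  have hmean : ∀ᶠ n : ℕ in atTop, ∫ ω', X n 0 ω' ∂(P n) = m := by
    filter_upwards [eventually_gt_atTop 0] with n hn using (hA.law_X n 0 hn).integral_eq
  have halim : Tendsto a atTop atTop :=
    (tendsto_natCast_rpow_atTop (by linarith)).const_mul_atTop hc
  obtain ⟨C, hC, htail⟩ := hμ₂.exists_truncatedLaw_tail_le hα.1 hγ₁
  have hε := eventually_natCast_rpow_neg_mem hγ₂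
  have hw1 : ∀ n : ℕ, 0 < (n : ℝ) → n * (n : ℝ) ^ (-γ₂) = (n : ℝ) ^ (1 - γ₂) := fun n hn => by
    rw [sub_eq_add_neg, Real.rpow_add hn, Real.rpow_one]
  have hwa : ∀ n : ℕ, 0 < (n : ℝ) → n * (n : ℝ) ^ (-γ₂) * a n ^ (-α) = c ^ (-α) := fun n hn => by
    rw [hw1 n hn, ha, Real.mul_rpow hc.le (by positivity), ← Real.rpow_mul hn.le, mul_neg, hpα,
      mul_left_comm, ← Real.rpow_add hn, add_neg_cancel, Real.rpow_zero, mul_one]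
  have hw : Tendsto (fun n : ℕ => n * (n : ℝ) ^ (-γ₂) / a n) atTop (𝓝 0) := by
    have hlt : 1 - γ₂ - p < 0 := by
      have : 1 - γ₂ < p := by
        rw [← hpα]
        exact mul_lt_of_lt_one_right (by linarith) hα.2
      linarith
    have hlim := (tendsto_natCast_rpow_zero hlt).const_mul c⁻¹
    rw [mul_zero] at hlim
    refine hlim.congr' ?_
    filter_upwards [eventually_natCast_pos] with n hn
    rw [hw1 n hn, ha, Real.rpow_sub hn]
    field_simp
  have hτ : Tendsto (fun n : ℕ => n / a n ^ 2) atTop (𝓝 0) := by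
    have hlim := (tendsto_natCast_rpow_zero
      (show 1 - p * 2 < 0 by linarith)).const_mul (c ^ 2)⁻¹
    rw [mul_zero] at hlim
    refine hlim.congr' ?_
    filter_upwards [eventually_natCast_pos] with n hn
    rw [ha, mul_pow, Real.rpow_sub hn, Real.rpow_one, Real.rpow_mul hn.le, Real.rpow_two]
    field_simp
  have hlim : ∀ x : ℝ, 0 < x → Tendsto (fun n : ℕ => n * (n : ℝ) ^ (-γ₂) *
      (truncatedLaw μ₂ ((n : ℝ) ^ γ₁)).real (Ioi (a n * x))) atTop
      (𝓝 ((oneSidedLevyMeasure α (α * c ^ (-α))).real (Ioi x))) := by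
    intro x hx
    have hxα : 0 ≤ x ^ (-α) := by positivity
    rw [measureReal_def, oneSidedLevyMeasure_Ioi hα0 hs hx,
      ENNReal.toReal_ofReal (by positivity), mul_div_cancel_left₀ _ hα0.ne']
    have hT := hμ₂.tendsto_tail
    have hmass := (hμ₂.tendsto_real_Iic.comp (tendsto_natCast_rpow_atTop hγ₁)).inv₀ one_ne_zero
    have hA1 := (hT.comp (halim.atTop_mul_const hx)).const_mul (c ^ (-α) * x ^ (-α))
    have hA2 := (tendsto_natCast_rpow_zero (show 1 - γ₂ - γ₁ * α < 0 by linarith)).mul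
      (hT.comp (tendsto_natCast_rpow_atTop hγ₁))
    have hall := hmass.mul (hA1.sub hA2)
    rw [inv_one, one_mul, mul_one, zero_mul, sub_zero] at hall
    refine hall.congr' ?_
    -- the level `a n * x` is eventually below the truncation level
    have hbelow : ∀ᶠ n : ℕ in atTop, a n * x ≤ (n : ℝ) ^ γ₁ := by
      have hl := (tendsto_natCast_rpow_zero (show p - γ₁ < 0 by linarith)).mul_const (c * x)
      rw [zero_mul] at hl
      filter_upwards [hl.eventually (ge_mem_nhds zero_lt_one), eventually_natCast_pos] with n h3 hn
      rw [Real.rpow_sub hn, div_mul_eq_mul_div, div_le_one (by positivity)] at h3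
      rw [ha]
      linarith
    filter_upwards [hbelow, eventually_natCast_pos, halim.eventually_gt_atTop 0]
      with n hbelow hn han
    rw [truncatedLaw_real_Ioi hbelow]
    simp only [Function.comp_apply]
    have e1 : x ^ (-α) * x ^ α = 1 := by rw [← Real.rpow_add hx]; simp
    have e2 : a n ^ (-α) * a n ^ α = 1 := by rw [← Real.rpow_add han]; simp
    have e3 : (n : ℝ) ^ (1 - γ₂ - γ₁ * α) * ((n : ℝ) ^ γ₁) ^ α = n * (n : ℝ) ^ (-γ₂) := by
      rw [← Real.rpow_mul hn.le, ← Real.rpow_add hn, hw1 n hn]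
      congr 1
      ring
    rw [← hwa n hn, Real.mul_rpow han.le hx.le, ← mul_assoc ((n : ℝ) ^ (1 - γ₂ - γ₁ * α)), e3]
    linear_combination ((μ₂.real (Iic ((n : ℝ) ^ γ₁)))⁻¹ * (n * (n : ℝ) ^ (-γ₂)) *
      μ₂.real (Ioi (a n * x))) * (a n ^ (-α) * a n ^ α * e1 + e2)
  have hmain := tendsto_affineCharFun_mixtureLaw (D := c ^ (-α)) hα (by positivity)
    (div_nonneg hs hα0.le) hμ2 hε
    (tendsto_natCast_rpow_zero (neg_lt_zero.2 hγ₂))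
    ((eventually_half_lt_real_Iic hμ₂ hγ₁).mono fun n hn =>
      isProbabilityMeasure_truncatedLaw (by linarith))
    (Eventually.of_forall fun n => (hμ₂.ae_mem_Icc ((n : ℝ) ^ γ₁)).mono fun y hy =>
      zero_lt_one.trans_le hy.1)
    htail halim hτ (eventually_natCast_pos.mono fun n hn => (hwa n hn).le) hw
    (hasPowerTail_oneSidedLevyMeasure hα0 hs) hlim
  have ha0 : ∀ᶠ n : ℕ in atTop, 0 < a n := halim.eventually_gt_atTop 0
  -- the centring differs from `n m` by a multiple of the scale which tends to `limitShift`
  have hr : Tendsto (fun n : ℕ => (kappa α γ₂ c m n - n * m) / a n) atTop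
      (𝓝 (limitShift α γ₂)) := by
    have h1α : 1 - α ≠ 0 := by linarith [hα.2]
    unfold kappa limitShift
    split_ifs with hlt heq
    · simp
    · refine tendsto_const_nhds.congr' ?_
      filter_upwards [eventually_natCast_pos] with n hn
      rw [← hp, add_sub_cancel_left, ha]
      field_simp
    · have hlt' : γ₂ < 1 - α := lt_of_le_of_ne (not_lt.1 hlt) heq
      have hp1 : 1 - p < 0 := by
        have : 1 < p := by rw [hp, lt_div_iff₀ hα0]; linarith
        linarith
      have hl := ((tendsto_natCast_rpow_zero hp1).mul_const (m / c)).const_sub (α / (1 - α))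
      rw [zero_mul, sub_zero] at hl
      refine hl.congr' ?_
      filter_upwards [eventually_natCast_pos] with n hn
      rw [← hp, ha, Real.rpow_sub hn, Real.rpow_one]
      field_simp
  refine hA.tendstoInDistribution (b := fun _ => m)
    (ψ := stableExponent α (α * c ^ (-α)))
    ((hA.eventually_hasLaw_mix hμ₂ hγ₁).mono fun n hn => hn.1) ha0 ?_ hr (fun u => ?_)
    (by fun_prop) (fun u => ?_)
  · filter_upwards [hmean, ha0] with n hn han
    rw [hn, div_mul_cancel₀ _ han.ne']
    ring
  · have h3 := hmain u
    rw [zero_mul, zero_mul, Complex.ofReal_zero, neg_zero, zero_add] at h3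
    exact h3
  · simp only [sub_eq_add_neg]
    rw [charFun_map_add_const, hFchar, mul_comm]
    congr 2
    simp only [RCLike.inner_apply, conj_trivial]
    push_cast
    ring

end

end MixtureLimit

theorem theorem1
    (α lam γ₁ γ₂ : ℝ) (hα : α ∈ Ioo (0 : ℝ) 1) (hlam : 0 < lam) (hγ₁ : 0 < γ₁) (hγ₂ : 0 < γ₂)
    (μ₁ μ₂ : Measure ℝ) (hμ₁ : MixtureLimit.IsLightTail lam μ₁)
    (hμ₂ : MixtureLimit.IsHeavyTail α μ₂)
    {Ω : ℕ → Type*} [∀ n, MeasurableSpace (Ω n)]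
    (P : (n : ℕ) → Measure (Ω n)) [∀ n, IsProbabilityMeasure (P n)]
    (X Y B : (n : ℕ) → ℕ → Ω n → ℝ)
    (hA : MixtureLimit.IsMixtureArray μ₁ μ₂ γ₁ γ₂ P X Y B) :
    -- the means and variances below are those of square integrable variables
    (∀ᶠ n in atTop, MemLp (X n 0) 2 (P n) ∧
      MemLp (MixtureLimit.mix (X n 0) (Y n 0) (B n 0)) 2 (P n)) ∧
    -- (i)
    (((2 - α) * γ₁ < γ₂ ∨ γ₂ < min ((2 - α) * γ₁) (1 - α * γ₁)) →
      TendstoInDistribution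
        (fun (n : ℕ) (ω : Ω n) =>
          (MixtureLimit.rowSum X Y B n ω
              - n * ∫ ω', MixtureLimit.mix (X n 0) (Y n 0) (B n 0) ω' ∂(P n)) /
            √(n * variance (MixtureLimit.mix (X n 0) (Y n 0) (B n 0)) (P n)))
        atTop (id : ℝ → ℝ) P (gaussianReal 0 1)) ∧
    -- (ii)
    ((1 / 2 < γ₁ ∧ γ₂ ∈ Ioo (1 - α / 2) ((2 - α) * γ₁)) →
      TendstoInDistribution
        (fun (n : ℕ) (ω : Ω n) =>
          (MixtureLimit.rowSum X Y B n ω - n * ∫ ω', X n 0 ω' ∂(P n)) /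
            √(n * variance (X n 0) (P n)))
        atTop (id : ℝ → ℝ) P (gaussianReal 0 1)) ∧
    -- (iii)
    ((1 / 2 < γ₁ ∧ γ₂ ∈ Ioo (max (1 - α * γ₁) 0) (1 - α / 2)) →
      ∀ c : ℝ, 0 < c → ∃ F : ProbabilityMeasure ℝ,
        MixtureLimit.IsOneSidedStable α (α * c ^ (-α)) (F : Measure ℝ) ∧
        TendstoInDistribution
          (fun (n : ℕ) (ω : Ω n) =>
            (MixtureLimit.rowSum X Y B n ω
                - MixtureLimit.kappa α γ₂ c (∫ ω', X n 0 ω' ∂(P n)) n) /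
              (c * (n : ℝ) ^ ((1 - γ₂) / α)))
          atTop (fun x : ℝ => x - MixtureLimit.limitShift α γ₂) P (F : Measure ℝ)) := by
  refine ⟨?_, fun h => hA.tendstoInDistribution_gaussian_self hα hlam hγ₁ hγ₂ hμ₁ hμ₂ h,
    fun h => hA.tendstoInDistribution_gaussian_light hα hlam hγ₁ hγ₂ hμ₁ hμ₂ h.2.1,
    fun h c hc => hA.tendstoInDistribution_stable hα hlam hγ₁ hγ₂ hμ₁ hμ₂
      ((le_max_left _ _).trans_lt h.2.1) h.2.2 hc⟩
  filter_upwards [hA.eventually_hasLaw_mix hμ₂ hγ₁, eventually_gt_atTop 0] with n hn hn0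
  have h2 := hμ₁.memLp_two hlam
  exact ⟨MixtureLimit.memLp_of_hasLaw (hA.law_X n 0 hn0) h2, MixtureLimit.memLp_of_hasLaw hn.2
    (MixtureLimit.memLp_two_mixtureLaw h2 (hμ₂.memLp_truncatedLaw _))⟩
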